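/- Let $n,k\ge 0$ be integers. For a commutative ring $A$ and $q\in A$, let $\mathcal H_n(A,q)$ be the Hecke algebra of the symmetric group $\mathfrak S_n$: the unital associative $A$-algebra generated by $T_1,\dots,T_{n-1}$ subject to $T_i^2=(q-1)T_i+q$, $T_iT_j=T_jT_i$ for $|i-j|>1$, and $T_iT_{i+1}T_i=T_{i+1}T_iT_{i+1}$. Put $$\mathcal B_m=\sum_{i=1}^m T_{m-1}T_{m-2}\cdots T_i,\qquad \mathcal B_m^*=\sum_{i=1}^m T_iT_{i+1}\cdots T_{m-1}\qquad(\mathcal B_m=\mathcal B^*_m=0\text{ for } m\le 0),$$ $$\mathcal B_{n,k}=\mathcal B_{n-k+1}\cdots\mathcal B_{n-1}\mathcal B_n,\qquad \mathcal B^*_{n,k}=\mathcal B^*_n\mathcal B^*_{n-1}\cdots\mathcal B^*_{n-k+1},$$ and $[k]!_q=\prod_{i=1}^k(1+q+\cdots+q^{i-1})$. (0) For an indeterminate $t$, there is a unique element $r\in\mathcal H_n(\mathbb Z[t],t)$ with $[k]!_t\, r=\mathcal B^*_{n,k}\mathcal B_{n,k}$. For a field $K$ and any $q\in K$, let $\mathcal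 R_{n,k}\in\mathcal H_n(K,q)$ be the image of $r$ under the substitution $t\mapsto q$; thus $\mathcal R_{n,k}=\frac1{[k]!_q}\mathcal B^*_{n,k}\mathcal B_{n,k}$ whenever $[k]!_q\ne0$. For a partition $\lambda$ of $n$, let $S^\lambda$ be the Specht module of $\mathcal H_n(K,q)$, obtained for every $q\in K$ (including $q=0$ and roots of unity) by the substitution $t\mapsto q$ in the generic Specht module $x_\lambda T_{w_\lambda}\tilde y_{\lambda'}\,\mathcal H_n(\mathbb Z[t],t)$, i.e. $S^\lambda=K\otimes_{\mathbb Z[t]}\bigl(x_\lambda T_{w_\lambda}\tilde y_{\lambda'}\,\mathcal H_n(\mathbb Z[t],t)\bigr)$, a right $\mathcal H_n(K,q)$-module. Here $x_\lambda=\sum_{w}T_w$ over the Young subgroup $\mathfrak S_\lambda$ of the row lengths; $\tilde y_{\lambda'}=\sum_w(-1)^{\ell(w)}t^{N-\ell(w)}T_w$ over the Young subgroup $\mathfrak S_{\lambda'}$ of the column lengths, $N$ being the largest length of an element of $\mathfrak S_{\lambda'}$; and $w_\lambda$ is the permutation that sends the position of each cell of $\lambda$ in the column-by-column reading to its position in the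 row-by-row reading. Then the eigenvalues of $\mathcal R_{n,k}$ are polynomials in $q$ with nonnegative integer coefficients, uniformly in $K$ and $q$: (1) There is a finite set $P\subset\mathbb Z_{\ge0}[t]$, depending only on $n$ and $k$, such that for every field $K$ and every $q\in K$ the set of eigenvalues in $K$ of the right multiplication $a\mapsto a\,\mathcal R_{n,k}$ on $\mathcal H_n(K,q)$ is exactly $\{p(q): p\in P\}$. (2) For each partition $\lambda$ of $n$ there is a finite set $P_\lambda\subset\mathbb Z_{\ge0}[t]$, depending only on $\lambda$ and $k$, such that for every field $K$ and every $q\in K$ the set of eigenvalues in $K$ of $\mathcal R_{n,k}$ acting from the right on $S^\lambda$ is exactly $\{p(q): p\in P_\lambda\}$. -/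

import Mathlib

open Polynomial TensorProduct

namespace HeckeShuffle

noncomputable section

/-! ### The Hecke algebra of the symmetric group, by generators and relations -/

/-- The defining relations of the Hecke algebra. The index `i : Fin (n - 1)` stands for the
generator usually written `T_{i+1}`. -/
inductive Rel (R : Type*) [CommRing R] (q : R) (n : ℕ) :
    FreeAlgebra R (Fin (n - 1)) → FreeAlgebra R (Fin (n - 1)) → Prop
  | quadratic (i : Fin (n - 1)) :
      Rel R q n (FreeAlgebra.ι R i * FreeAlgebra.ι R i)
        ((q - 1) • FreeAlgebra.ι R i + q • (1 : FreeAlgebra R (Fin (n - 1))))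
  | commute (i j : Fin (n - 1)) (h : (i : ℕ) + 1 < j ∨ (j : ℕ) + 1 < i) :
      Rel R q n (FreeAlgebra.ι R i * FreeAlgebra.ι R j) (FreeAlgebra.ι R j * FreeAlgebra.ι R i)
  | braid (i j : Fin (n - 1)) (h : (j : ℕ) = i + 1) :
      Rel R q n (FreeAlgebra.ι R i * FreeAlgebra.ι R j * FreeAlgebra.ι R i)
        (FreeAlgebra.ι R j * FreeAlgebra.ι R i * FreeAlgebra.ι R j)

/-- The Hecke algebra `H_n(q)` of the symmetric group `S_n` over the commutative ring `R`. -/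
def Hecke (R : Type*) [CommRing R] (q : R) (n : ℕ) : Type _ :=
  RingQuot (Rel R q n)

section Basic

variable (R : Type*) [CommRing R] (q : R) (n : ℕ)

instance : Ring (Hecke R q n) := inferInstanceAs (Ring (RingQuot (Rel R q n)))

instance : Algebra R (Hecke R q n) := inferInstanceAs (Algebra R (RingQuot (Rel R q n)))

/-- The generators of the Hecke algebra. -/
def gen (i : Fin (n - 1)) : Hecke R q n :=
  RingQuot.mkAlgHom R (Rel R q n) (FreeAlgebra.ι R i)

theorem gen_mul_self (i : Fin (n - 1)) :
    gen R q n i * gen R q n i = (q - 1) • gen R q n i + q • (1 : Hecke R q n) := by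
  have h := RingQuot.mkAlgHom_rel R (Rel.quadratic (q := q) (n := n) i)
  simp only [map_mul, map_add, map_smul, map_one] at h
  exact h

theorem gen_commute (i j : Fin (n - 1)) (h : (i : ℕ) + 1 < j ∨ (j : ℕ) + 1 < i) :
    gen R q n i * gen R q n j = gen R q n j * gen R q n i := by
  have h := RingQuot.mkAlgHom_rel R (Rel.commute (q := q) (n := n) i j h)
  simp only [map_mul] at h
  exact h

theorem gen_braid (i j : Fin (n - 1)) (h : (j : ℕ) = i + 1) :
    gen R q n i * gen R q n j * gen R q n i = gen R q n j * gen R q n i * gen R q n j := by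
  have h := RingQuot.mkAlgHom_rel R (Rel.braid (q := q) (n := n) i j h)
  simp only [map_mul] at h
  exact h

end Basic

/-- The universal property of the Hecke algebra. -/
def lift {R : Type*} [CommRing R] {q : R} {n : ℕ} {A : Type*} [Ring A] [Algebra R A]
    (t : Fin (n - 1) → A)
    (hq : ∀ i, t i * t i = (q - 1) • t i + q • (1 : A))
    (hc : ∀ i j : Fin (n - 1), ((i : ℕ) + 1 < j ∨ (j : ℕ) + 1 < i) → t i * t j = t j * t i)
    (hb : ∀ i j : Fin (n - 1), (j : ℕ) = i + 1 → t i * t j * t i = t j * t i * t j) :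
    Hecke R q n →ₐ[R] A :=
  RingQuot.liftAlgHom R ⟨FreeAlgebra.lift R t, by
    intro x y h
    induction h with
    | quadratic i => simpa using hq i
    | commute i j h => simpa using hc i j h
    | braid i j h => simpa using hb i j h⟩

@[simp]
theorem lift_gen {R : Type*} [CommRing R] {q : R} {n : ℕ} {A : Type*} [Ring A] [Algebra R A]
    (t : Fin (n - 1) → A) (hq hc hb) (i : Fin (n - 1)) :
    lift (R := R) (q := q) t hq hc hb (gen R q n i) = t i :=
  (RingQuot.liftAlgHom_mkAlgHom_apply R _ _ _).trans (FreeAlgebra.lift_ι_apply t i)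

/-! ### The shuffling elements -/

/-- The `q`-integer `[m]_q = 1 + q + ⋯ + q ^ (m - 1)`. -/
def qInt {R : Type*} [CommRing R] (q : R) (m : ℕ) : R := ∑ j ∈ Finset.range m, q ^ j

/-- The `q`-factorial `[k]!_q = [1]_q [2]_q ⋯ [k]_q`. -/
def qFactorial {R : Type*} [CommRing R] (q : R) (k : ℕ) : R :=
  ∏ i ∈ Finset.Icc 1 k, qInt q i

section Shuffles

variable (R : Type*) [CommRing R] (q : R) (n : ℕ)

/-- The generator `T_i` of `H_n` with the customary index `1 ≤ i ≤ n - 1` (and `0` for all other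
`i`; those are never used below). -/
def T (i : ℕ) : Hecke R q n :=
  if h : 1 ≤ i ∧ i < n then gen R q n ⟨i - 1, by omega⟩ else 0

/-- `B_m = ∑_{i=1}^m T_{m-1} T_{m-2} ⋯ T_i`, as an element of `H_n`, for `m ≤ n`. -/
def B (m : ℕ) : Hecke R q n :=
  ∑ i ∈ Finset.Icc 1 m, ((List.range' i (m - i)).reverse.map (T R q n)).prod

/-- `B*_m = ∑_{i=1}^m T_i T_{i+1} ⋯ T_{m-1}`, as an element of `H_n`, for `m ≤ n`. -/
def Bstar (m : ℕ) : Hecke R q n :=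
  ∑ i ∈ Finset.Icc 1 m, ((List.range' i (m - i)).map (T R q n)).prod

/-- `B_{n,k} = B_{n-(k-1)} ⋯ B_{n-1} B_n`. (For `k > n` a factor `B_0 = 0` occurs.) -/
def kBottomToRandom (k : ℕ) : Hecke R q n :=
  ((List.range k).reverse.map fun j => B R q n (n - j)).prod

/-- `B*_{n,k} = B*_n B*_{n-1} ⋯ B*_{n-(k-1)}`. -/
def kRandomToBottom (k : ℕ) : Hecke R q n :=
  ((List.range k).map fun j => Bstar R q n (n - j)).prod

end Shuffles

/-- The `k`-random-to-random shuffle `R_{n,k} = (1 / [k]!_q) B*_{n,k} B_{n,k}` for an indeterminate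
`q`: the element `r` of the Hecke algebra over `ℤ[q]` with `[k]!_q r = B*_{n,k} B_{n,k}`. -/
def genericRandomToRandom (n k : ℕ) : Hecke ℤ[X] X n :=
  Classical.epsilon fun r =>
    qFactorial (X : ℤ[X]) k • r = kRandomToBottom ℤ[X] X n k * kBottomToRandom ℤ[X] X n k

section Specialization

variable {K : Type*} [Field K] (q : K) (n : ℕ)

/-- The ring homomorphism `ℤ[X] → K` that substitutes `q` for the indeterminate. -/
abbrev evalHom : ℤ[X] →+* K := eval₂RingHom (Int.castRingHom K) q

/-- Substituting `q` for the indeterminate: the ring homomorphism from the Hecke algebra over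
`ℤ[X]` (with parameter `X`) to the Hecke algebra over `K` with parameter `q` that sends each
generator to the corresponding generator and each scalar `f` to `f(q)`. -/
def specialize : Hecke ℤ[X] X n →+* Hecke K q n :=
  letI : Algebra ℤ[X] (Hecke K q n) := Algebra.compHom _ (evalHom q)
  (lift (A := Hecke K q n) (gen K q n)
    (fun i => by
      rw [gen_mul_self]
      change _ = evalHom q (X - 1) • gen K q n i + evalHom q X • (1 : Hecke K q n)
      simp)
    (gen_commute K q n) (gen_braid K q n) : Hecke ℤ[X] X n →ₐ[ℤ[X]] Hecke K q n)

theorem specialize_gen (i : Fin (n - 1)) : specialize q n (gen ℤ[X] X n i) = gen K q n i := by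
  let _ : Algebra ℤ[X] (Hecke K q n) := Algebra.compHom _ (evalHom q)
  exact lift_gen _ _ _ _ i

theorem specialize_smul (f : ℤ[X]) (a : Hecke ℤ[X] X n) :
    specialize q n (f • a) = evalHom q f • specialize q n a := by
  let _ : Algebra ℤ[X] (Hecke K q n) := Algebra.compHom _ (evalHom q)
  exact map_smul (lift (A := Hecke K q n) (gen K q n) _ _ _ :
    Hecke ℤ[X] X n →ₐ[ℤ[X]] Hecke K q n) f a

/-- The `k`-random-to-random shuffle `R_{n,k}` in the Hecke algebra `H_n(q)` over a field `K`,
for an arbitrary `q` in `K`. -/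
def randomToRandom (k : ℕ) : Hecke K q n := specialize q n (genericRandomToRandom n k)

end Specialization

/-! ### The basis elements `T_w` -/

/-- The simple transpositions. -/
def simpleTransposition {n : ℕ} (i : Fin (n - 1)) : Equiv.Perm (Fin n) :=
  Equiv.swap ⟨i, by omega⟩ ⟨i + 1, by omega⟩

theorem exists_word {n : ℕ} (w : Equiv.Perm (Fin n)) :
    ∃ l : List (Fin (n - 1)), (l.map simpleTransposition).prod = w := by
  cases n with
  | zero => exact ⟨[], Subsingleton.elim _ _⟩
  | succ m =>
    have h : w ∈ Submonoid.closure
        (Set.range fun i : Fin m => Equiv.swap i.castSucc i.succ) := by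
      rw [Equiv.Perm.mclosure_swap_castSucc_succ]; trivial
    induction h using Submonoid.closure_induction with
    | mem x hx =>
      obtain ⟨i, rfl⟩ := hx
      exact ⟨[i], by simp [simpleTransposition]; rfl⟩
    | one => exact ⟨[], rfl⟩
    | mul x y _ _ hx hy =>
      obtain ⟨a, rfl⟩ := hx
      obtain ⟨b, rfl⟩ := hy
      exact ⟨a ++ b, by simp⟩

theorem exists_reducedWord {n : ℕ} (w : Equiv.Perm (Fin n)) :
    ∃ l : List (Fin (n - 1)), (l.map simpleTransposition).prod = w ∧
      ∀ l' : List (Fin (n - 1)), (l'.map simpleTransposition).prod = w → l.length ≤ l'.length := by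
  have hne : {l : List (Fin (n - 1)) | (l.map simpleTransposition).prod = w}.Nonempty :=
    exists_word w
  exact ⟨Function.argminOn List.length _ hne, Function.argminOn_mem List.length _ hne,
    fun l' hl' => Function.argminOn_le List.length _ hl'⟩

/-- A reduced expression of a permutation. -/
def reducedWord {n : ℕ} (w : Equiv.Perm (Fin n)) : List (Fin (n - 1)) :=
  (exists_reducedWord w).choose

/-- The Coxeter length of a permutation. -/
def length {n : ℕ} (w : Equiv.Perm (Fin n)) : ℕ := (reducedWord w).length

/-- The basis element `T_w` of the Hecke algebra. -/
def TPerm (R : Type*) [CommRing R] (q : R) {n : ℕ} (w : Equiv.Perm (Fin n)) : Hecke R q n :=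
  ((reducedWord w).map (gen R q n)).prod

/-! ### Specht modules -/

section Specht

variable {n : ℕ} (μ : YoungDiagram) (hμ : μ.card = n)

/-- The cells of `μ` listed row by row, from top to bottom, each row from left to right. -/
def rowReading : Fin n ≃ μ.cells :=
  ((μ.cells.map toLex.toEmbedding).orderIsoOfFin
    (by rw [Finset.card_map]; exact hμ)).toEquiv.trans (Finset.equivMap _ _).symm

/-- The cells of `μ` listed column by column, from left to right, each column from top to
bottom. -/
def colReading : Fin n ≃ μ.cells :=
  ((μ.cells.map ((Equiv.prodComm ℕ ℕ).trans toLex).toEmbedding).orderIsoOfFin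
    (by rw [Finset.card_map]; exact hμ)).toEquiv.trans (Finset.equivMap _ _).symm

/-- The Young subgroup of the row lengths of `μ` (as a finite set of permutations). -/
def rowSubgroup : Finset (Equiv.Perm (Fin n)) :=
  {w | ∀ i, (rowReading μ hμ (w i)).1.1 = (rowReading μ hμ i).1.1}

/-- The Young subgroup of the column lengths of `μ` (as a finite set of permutations). -/
def colSubgroup : Finset (Equiv.Perm (Fin n)) :=
  {w | ∀ i, (colReading μ hμ (w i)).1.2 = (colReading μ hμ i).1.2}

/-- The permutation that relates the column reading of `μ` to the row reading. -/
def readingPerm : Equiv.Perm (Fin n) := (colReading μ hμ).trans (rowReading μ hμ).symm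

/-- `x_μ = ∑ T_w`, summed over the Young subgroup of the row lengths of `μ`. -/
def symmetrizer : Hecke ℤ[X] X n := ∑ w ∈ rowSubgroup μ hμ, TPerm ℤ[X] X w

/-- `q^N y_{μ'}` with `y_{μ'} = ∑ (-q)^{-ℓ(w)} T_w`, summed over the Young subgroup of the column
lengths of `μ`. Here `N = ∑_j (μ'_j choose 2)` is the largest length in that subgroup, so that the
factor `q^N` clears the denominators. -/
def antisymmetrizer : Hecke ℤ[X] X n :=
  ∑ w ∈ colSubgroup μ hμ,
    ((-1) ^ length w * X ^ ((∑ c ∈ μ.cells, c.1) - length w) : ℤ[X]) • TPerm ℤ[X] X w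

/-- The generator `x_μ T_w y_{μ'}` of the Specht module. -/
def spechtGenerator : Hecke ℤ[X] X n :=
  symmetrizer μ hμ * TPerm ℤ[X] X (readingPerm μ hμ) * antisymmetrizer μ hμ

/-- The Specht module of shape `μ` for an indeterminate `q`, in the form of Dipper and James: the
right ideal `x_μ T_w y_{μ'} H_n` of the Hecke algebra over `ℤ[q]`. It is a free `ℤ[q]`-module, with
one basis element for each standard tableau of shape `μ`. -/
def genericSpecht : Submodule ℤ[X] (Hecke ℤ[X] X n) :=
  LinearMap.range (LinearMap.mulLeft ℤ[X] (spechtGenerator μ hμ))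

theorem mul_mem_genericSpecht (a : Hecke ℤ[X] X n) :
    ∀ v ∈ genericSpecht μ hμ, LinearMap.mulRight ℤ[X] a v ∈ genericSpecht μ hμ := by
  rintro _ ⟨b, rfl⟩
  exact ⟨b * a, by simp [mul_assoc]⟩

/-- The action of an element of the Hecke algebra on the generic Specht module, by right
multiplication. -/
def genericSpechtMul (a : Hecke ℤ[X] X n) : Module.End ℤ[X] (genericSpecht μ hμ) :=
  (LinearMap.mulRight ℤ[X] a).restrict (mul_mem_genericSpecht μ hμ a)

variable {K : Type*} [Field K] (q : K)

/-- `K` as a `ℤ[X]`-algebra, the indeterminate acting as `q`. -/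
abbrev evalAlgebra : Algebra ℤ[X] K := (evalHom q).toAlgebra

/-- The Specht module of shape `μ` of the Hecke algebra `H_n(q)` over the field `K`: the generic
Specht module with `q` substituted for the indeterminate. -/
def Specht : Type _ :=
  letI := evalAlgebra q
  K ⊗[ℤ[X]] genericSpecht μ hμ

instance : AddCommGroup (Specht μ hμ q) :=
  letI := evalAlgebra q
  (TensorProduct.addCommGroup : AddCommGroup (K ⊗[ℤ[X]] genericSpecht μ hμ))

instance : Module K (Specht μ hμ q) :=
  letI := evalAlgebra q
  (TensorProduct.leftModule : Module K (K ⊗[ℤ[X]] genericSpecht μ hμ))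

/-- The endomorphism of `Specht μ hμ q` that `a` induces. -/
def spechtMul (a : Hecke ℤ[X] X n) : Module.End K (Specht μ hμ q) :=
  letI := evalAlgebra q
  ((genericSpechtMul μ hμ a).baseChange K :
    Module.End K (K ⊗[ℤ[X]] genericSpecht μ hμ))

theorem genericSpechtMul_mul (a b : Hecke ℤ[X] X n) :
    genericSpechtMul μ hμ (a * b) = genericSpechtMul μ hμ b * genericSpechtMul μ hμ a := by
  ext v
  simp [genericSpechtMul, mul_assoc]

theorem spechtMul_mul (a b : Hecke ℤ[X] X n) :
    spechtMul μ hμ q (a * b) = spechtMul μ hμ q b * spechtMul μ hμ q a := by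
  let _ := evalAlgebra q
  unfold spechtMul
  rw [genericSpechtMul_mul]
  exact LinearMap.baseChange_mul _ _

theorem spechtMul_add (a b : Hecke ℤ[X] X n) :
    spechtMul μ hμ q (a + b) = spechtMul μ hμ q a + spechtMul μ hμ q b := by
  let _ := evalAlgebra q
  have h : genericSpechtMul μ hμ (a + b) = genericSpechtMul μ hμ a + genericSpechtMul μ hμ b := by
    ext v
    simp [genericSpechtMul, mul_add]
  unfold spechtMul
  rw [h]
  exact LinearMap.baseChange_add _ _

theorem spechtMul_smul (f : ℤ[X]) (a : Hecke ℤ[X] X n) :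
    spechtMul μ hμ q (f • a) = evalHom q f • spechtMul μ hμ q a := by
  let _ := evalAlgebra q
  have h : genericSpechtMul μ hμ (f • a) = f • genericSpechtMul μ hμ a := by
    ext v
    simp [genericSpechtMul]
  unfold spechtMul
  rw [h]
  refine (LinearMap.baseChange_smul _ _).trans (LinearMap.ext fun v => ?_)
  exact algebra_compatible_smul (M := K ⊗[ℤ[X]] genericSpecht μ hμ) K f
    ((genericSpechtMul μ hμ a).baseChange K v)

theorem spechtMul_one : spechtMul μ hμ q (1 : Hecke ℤ[X] X n) = 1 := by
  let _ := evalAlgebra q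
  have h : genericSpechtMul μ hμ (1 : Hecke ℤ[X] X n) = LinearMap.id := by
    ext v
    simp [genericSpechtMul]
  unfold spechtMul
  rw [h]
  exact LinearMap.baseChange_id

/-- The right action of `H_n(q)` on its Specht module of shape `μ`, written as a homomorphism to
the opposite of the endomorphism algebra: `T_i` acts by right multiplication by `T_i`. -/
def spechtAction : Hecke K q n →ₐ[K] (Module.End K (Specht μ hμ q))ᵐᵒᵖ :=
  lift (fun i => MulOpposite.op (spechtMul μ hμ q (gen ℤ[X] X n i)))
    (fun i => by
      rw [← MulOpposite.op_mul, ← spechtMul_mul, gen_mul_self, spechtMul_add, spechtMul_smul,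
        spechtMul_smul, spechtMul_one]
      simp)
    (fun i j h => by
      rw [← MulOpposite.op_mul, ← MulOpposite.op_mul, ← spechtMul_mul, ← spechtMul_mul,
        gen_commute _ _ _ i j h])
    (fun i j h => by
      simp only [← MulOpposite.op_mul, ← spechtMul_mul]
      rw [gen_braid _ _ _ i j h])

end Specht

end

end HeckeShuffle

/-!
The existence of `r` is a factorization. `B*_{n,k}` is a sum over coset representatives times an
element that acts as `[k]!_q` on every vector `v` with `T_i v = q v` for the last `k - 1` indices
`i` (`exists_kRandomToBottom_eq`), and `B_{n,k}` is such a vector (`T_mul_kBottomToRandom`).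
Uniqueness holds because the Hecke algebra over `ℤ[q]` is free (`nonempty_basis`).

The eigenvalues are first found over an algebraically closed field in which `q` is generic. Write
`D(m, k) = B*_{m,k} B_{m,k}` and let `Z_m` be the Jucys–Murphy elements, with eigenvalues
`[m + c]_q` for contents `c`. The recursion (`B_mul_shuffleProd`)
`B_{m+1} D(m+1, k+1) = (q^{k+1} D(m, k+1) + [k+1]_q q^{-k} (Z_{m+1} - [k]_q) D(m, k)) B_{m+1}`
moves an eigenvector `v` of `D(n, k)` down to `u = B_{j+1} ⋯ B_n v ≠ 0` with `B_j u = 0`, and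
expresses the eigenvalue through the action of `Z_{j+1}, …, Z_n` alone. It remains to see that their
eigenvalues on `u` are of the form `[d]_q` with `d ≥ m - j` for `Z_m`; then the recursion has only
nonnegative coefficients (`exists_jmShuffle_mul_eq`). In the multiplicative form
`L_m = q^{-m} (1 + (q - 1) Z_m)` the elements satisfy `T_m L_m T_m = q L_{m+1}`. This affine Hecke
relation shows that the eigenvalues of `L_{j+1}` are `q^c` with `c ≥ -j`. As `T_i u = q u` for
`j < i < n`, the Bernstein relation confines the eigenvalues of `L_{m+1}` on `u` to those of `L_m`
and their multiples by `q`, so that the bound persists for all `m > j`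
(`exists_aeval_jmMul_mul_eq_zero`). No representation theory of the Hecke algebra at generic `q`
is used.

The passage to arbitrary `K` and `q` is commutative algebra (`exists_finset_hasEigenvalue_iff`). Let
`f` be an endomorphism of a finite torsion-free `ℤ[q]`-module whose generic eigenvalues all lie in
`ℤ[q]`. Its generic characteristic polynomial has coefficients in `ℤ[q]` and annihilates `f`, so a
specialization of `f` has no eigenvalues but the specialized ones. Conversely, for a generic
eigenvalue `s` the cokernel of `f - s` is a faithful module, so by Nakayama's lemma none of its
fibres vanishes, and `s` specializes to an eigenvalue everywhere. The Specht module enters only as a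
submodule of the Hecke algebra.
-/

namespace HeckeShuffle

noncomputable section

/-! ### Relations and Jucys–Murphy elements -/

section Relations

variable {R : Type*} [CommRing R] {q : R} {n : ℕ}

theorem T_of_lt {i : ℕ} (h : i < n - 1) : T R q n (i + 1) = gen R q n ⟨i, h⟩ := by
  simp [T, show i + 1 < n by omega]

theorem T_eq_zero {i : ℕ} (h : i = 0 ∨ n ≤ i) : T R q n i = 0 := by
  rw [T, dif_neg (by omega)]

theorem T_mul_self {i : ℕ} (h1 : 1 ≤ i) (hn : i < n) :
    T R q n i * T R q n i = (q - 1) • T R q n i + q • (1 : Hecke R q n) := by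
  rw [T, dif_pos ⟨h1, hn⟩, gen_mul_self]

theorem T_comm {i j : ℕ} (h : i + 1 < j) :
    T R q n i * T R q n j = T R q n j * T R q n i := by
  unfold T
  split_ifs with h1 h2
  · exact gen_commute R q n _ _ (Or.inl (by simp only; omega))
  all_goals simp

theorem T_braid (i : ℕ) :
    T R q n i * T R q n (i + 1) * T R q n i = T R q n (i + 1) * T R q n i * T R q n (i + 1) := by
  unfold T
  split_ifs with h1 h2
  · exact gen_braid R q n _ _ (by simp only; omega)
  all_goals simp

theorem B_zero : B R q n 0 = 0 := by simp [B]

theorem Bstar_zero : Bstar R q n 0 = 0 := by simp [Bstar]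

theorem B_succ (m : ℕ) : B R q n (m + 1) = 1 + T R q n m * B R q n m := by
  rw [B, Finset.sum_Icc_succ_top (by omega), add_comm, B, Finset.mul_sum]
  congr 1
  · simp
  · refine Finset.sum_congr rfl fun i hi => ?_
    obtain ⟨h1, h2⟩ := Finset.mem_Icc.mp hi
    rw [show m + 1 - i = m - i + 1 by omega, List.range'_concat, List.reverse_append]
    simp [show i + (m - i) = m by omega]

theorem Bstar_succ (m : ℕ) : Bstar R q n (m + 1) = 1 + Bstar R q n m * T R q n m := by
  rw [Bstar, Finset.sum_Icc_succ_top (by omega), add_comm, Bstar, Finset.sum_mul]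
  congr 1
  · simp
  · refine Finset.sum_congr rfl fun i hi => ?_
    obtain ⟨h1, h2⟩ := Finset.mem_Icc.mp hi
    rw [show m + 1 - i = m - i + 1 by omega, List.range'_concat]
    simp [show i + (m - i) = m by omega]

theorem T_comm_B {m j : ℕ} (h : m < j) : Commute (T R q n j) (B R q n m) := by
  induction m with
  | zero => simp [B_zero]
  | succ m ih =>
    rw [B_succ]
    exact (Commute.one_right _).add_right (Commute.mul_right (T_comm h).symm (ih (by omega)))

theorem T_comm_Bstar {m j : ℕ} (h : m < j) : Commute (T R q n j) (Bstar R q n m) := by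
  induction m with
  | zero => simp [Bstar_zero]
  | succ m ih =>
    rw [Bstar_succ]
    exact (Commute.one_right _).add_right (Commute.mul_right (ih (by omega)) (T_comm h).symm)

/-- A product `B_m B_{m+1}` is symmetric for `T_m`. -/
theorem T_mul_B_mul_B {m : ℕ} (h : m < n) :
    T R q n m * (B R q n m * B R q n (m + 1)) = q • (B R q n m * B R q n (m + 1)) := by
  induction m with
  | zero => simp [B_zero]
  | succ m ih =>
    have ih := ih (by omega)
    have hq := T_mul_self (R := R) (q := q) (show 1 ≤ m + 1 by omega) h
    have hb := T_braid (R := R) (q := q) (n := n) m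
    have hc := (T_comm_B (R := R) (q := q) (n := n) (show m < m + 1 by omega)).eq
    rw [B_succ (m + 1), B_succ m]
    rw [B_succ m] at ih
    generalize T R q n (m + 1) = t at *
    generalize T R q n m = s at *
    generalize B R q n m = b at *
    linear_combination (norm := (simp only [mul_add, add_mul, sub_mul, smul_add, sub_smul,
      smul_mul_assoc, mul_smul_comm, mul_assoc, mul_one, one_mul, one_smul]; module))
      hq + hq * (s * b) - (t - q • 1) * s * hc - (t - q • 1) * s * hc * (s * b)
        - hb * (b * (1 + s * b)) + s * t * ih

/-- The Jucys–Murphy elements `Z_m = [m]_q + q^m J_m` in a form that needs no division by `q`;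
`Z_m` has the eigenvalues `[m + c]_q` with `c` a content. -/
def jm (R : Type*) [CommRing R] (q : R) (n : ℕ) : ℕ → Hecke R q n
  | 0 => 0
  | m + 1 => 1 + T R q n m + T R q n m * jm R q n m * T R q n m

theorem jm_succ (m : ℕ) :
    jm R q n (m + 1) = 1 + T R q n m + T R q n m * jm R q n m * T R q n m := rfl

/-- The commutation of `B_{m+1}` past `B*_{m+1}`, up to the Jucys–Murphy element `Z_{m+1}`; it is
the source of the recursion. -/
theorem B_mul_Bstar (m : ℕ) :
    B R q n (m + 1) * Bstar R q n (m + 1) =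
      jm R q n (m + 1) + Bstar R q n m * T R q n m * B R q n m := by
  induction m with
  | zero => simp [B_succ, Bstar_succ, B_zero, Bstar_zero, jm, T_eq_zero]
  | succ m ih =>
    have hb := T_braid (R := R) (q := q) (n := n) m
    have hc := (T_comm_B (R := R) (q := q) (n := n) (show m < m + 1 by omega)).eq
    have hc' := (T_comm_Bstar (R := R) (q := q) (n := n) (show m < m + 1 by omega)).eq
    rw [B_succ (m + 1), Bstar_succ (m + 1), jm_succ (m + 1)]
    rw [B_succ m, Bstar_succ m] at ih ⊢
    generalize T R q n (m + 1) = t at *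
    generalize T R q n m = s at *
    generalize B R q n m = b at *
    generalize Bstar R q n m = b' at *
    generalize jm R q n (m + 1) = z at *
    linear_combination (norm := noncomm_ring) t * ih * t - b' * hb * b
      + hc' * (s * b * t) - b' * t * s * hc

theorem T_comm_jm_of_lt {m j : ℕ} (h : m < j) : Commute (T R q n j) (jm R q n m) := by
  induction m with
  | zero => simp [jm]
  | succ m ih =>
    have h1 : Commute (T R q n j) (T R q n m) := (T_comm h).symm
    exact ((Commute.one_right _).add_right h1).add_right
      ((h1.mul_right (ih (by omega))).mul_right h1)

theorem T_comm_jm_of_gt {m i : ℕ} (h : i + 1 < m) (hm : m ≤ n) :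
    Commute (T R q n i) (jm R q n m) := by
  obtain rfl | h0 := Nat.eq_zero_or_pos i
  · simp [T_eq_zero]
  induction m, h using Nat.le_induction with
  | base =>
    have hb := T_braid (R := R) (q := q) (n := n) i
    have hq := T_mul_self (R := R) (q := q) (show 1 ≤ i + 1 by omega) (show i + 1 < n by omega)
    have hc := (T_comm_jm_of_lt (R := R) (q := q) (n := n) (show i < i + 1 by omega)).eq
    change T R q n i * jm R q n (i + 1 + 1) = jm R q n (i + 1 + 1) * T R q n i
    rw [jm_succ (i + 1), jm_succ i]
    generalize T R q n (i + 1) = t at *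
    generalize T R q n i = s at *
    generalize jm R q n i = z at *
    linear_combination (norm := (simp only [mul_add, add_mul, mul_sub, sub_mul, sub_smul,
      smul_mul_assoc, mul_smul_comm, mul_assoc, mul_one, one_mul, one_smul]; module))
      s * hq - hq * s + hb * t - t * hb + t * s * hq - hq * s * t
        + hb * z * s * t + t * s * hc * s * t - t * s * z * hb
  | succ m h ih =>
    have h1 : Commute (T R q n i) (T R q n m) := T_comm (by omega)
    exact ((Commute.one_right _).add_right h1).add_right
      ((h1.mul_right (ih (by omega))).mul_right h1)

theorem jm_comm {m l : ℕ} (hm : m ≤ n) (hl : l ≤ n) :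
    Commute (jm R q n m) (jm R q n l) := by
  wlog h : m ≤ l generalizing m l
  · exact (this hl hm (by omega)).symm
  obtain rfl | h := h.eq_or_lt
  · exact Commute.refl _
  induction m with
  | zero => simp [jm]
  | succ m ih =>
    have h1 : Commute (jm R q n l) (T R q n m) := (T_comm_jm_of_gt h hl).symm
    exact (((Commute.one_right _).add_right h1).add_right
      ((h1.mul_right (ih (by omega) (by omega) (by omega)).symm).mul_right h1)).symm

theorem B_comm_jm {m l : ℕ} (h : m < l) (hl : l ≤ n) : Commute (B R q n m) (jm R q n l) := by
  induction m with
  | zero => simp [B_zero]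
  | succ m ih =>
    rw [B_succ]
    exact (Commute.one_left _).add_left (Commute.mul_left (T_comm_jm_of_gt h hl) (ih (by omega)))

theorem Bstar_comm_jm {m l : ℕ} (h : m < l) (hl : l ≤ n) :
    Commute (Bstar R q n m) (jm R q n l) := by
  induction m with
  | zero => simp [Bstar_zero]
  | succ m ih =>
    rw [Bstar_succ]
    exact (Commute.one_left _).add_left (Commute.mul_left (ih (by omega)) (T_comm_jm_of_gt h hl))

end Relations

/-! ### The recursion for the shuffling elements -/

section Recursion

/-- The products `B*_{m,k} B_{m,k}` in `H_n`, for `m ≤ n`. -/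
def shuffleProd (R : Type*) [CommRing R] (q : R) (n : ℕ) : ℕ → ℕ → Hecke R q n
  | _, 0 => 1
  | 0, _ + 1 => 0
  | m + 1, k + 1 => Bstar R q n (m + 1) * shuffleProd R q n m k * B R q n (m + 1)

theorem shuffleProd_zero_right {R : Type*} [CommRing R] {q : R} {n : ℕ} (m : ℕ) :
    shuffleProd R q n m 0 = 1 := by
  cases m <;> rfl

theorem shuffleProd_succ_succ {R : Type*} [CommRing R] {q : R} {n : ℕ} (m k : ℕ) :
    shuffleProd R q n (m + 1) (k + 1) =
      Bstar R q n (m + 1) * shuffleProd R q n m k * B R q n (m + 1) := rfl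

theorem qInt_zero {R : Type*} [CommRing R] (q : R) : qInt q 0 = 0 := by simp [qInt]

theorem qInt_succ {R : Type*} [CommRing R] (q : R) (m : ℕ) :
    qInt q (m + 1) = q ^ m + qInt q m := by
  rw [qInt, Finset.sum_range_succ, add_comm, qInt]

theorem qInt_succ' {R : Type*} [CommRing R] (q : R) (m : ℕ) :
    qInt q (m + 1) = 1 + q * qInt q m := by
  rw [qInt, Finset.sum_range_succ', add_comm, qInt, Finset.mul_sum]
  simp [pow_succ']

theorem qFactorial_succ {R : Type*} [CommRing R] (q : R) (k : ℕ) :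
    qFactorial q (k + 1) = qFactorial q k * qInt q (k + 1) := by
  rw [qFactorial, Finset.prod_Icc_succ_top (by omega), qFactorial]

variable {F : Type*} [Field F] {q : F} {n : ℕ}

theorem T_comm_shuffleProd {m j : ℕ} (h : m < j) (k : ℕ) :
    Commute (T F q n j) (shuffleProd F q n m k) := by
  induction m generalizing k with
  | zero => cases k <;> simp [shuffleProd]
  | succ m ih =>
    cases k with
    | zero => simp [shuffleProd]
    | succ k => exact ((T_comm_Bstar h).mul_right (ih (by omega) k)).mul_right (T_comm_B h)

/-- On vectors on which `T_m` acts as `q`, the operators `T_m Z_m` and `Z_{m+1}` are related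
affinely. -/
theorem T_mul_jm_mul {m k : ℕ} (hq : q ≠ 0) {w : Hecke F q n}
    (hw : T F q n m * w = q • w) :
    T F q n m * ((jm F q n m - qInt q k • 1) * w) =
      q⁻¹ • ((jm F q n (m + 1) - qInt q (k + 2) • 1) * w) := by
  have e : qInt q (k + 2) = 1 + q * (1 + q * qInt q k) := by rw [qInt_succ', qInt_succ']
  rw [eq_inv_smul_iff₀ hq, jm_succ, e]
  generalize T F q n m = t at *
  generalize jm F q n m = z at *
  linear_combination (norm := (simp only [mul_add, add_mul, mul_sub, sub_mul, smul_sub,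
      smul_smul, add_smul, smul_mul_assoc, mul_smul_comm, mul_assoc, one_mul]; module))
      (-1 : F) • (t * z * hw) - hw - (q * qInt q k) • hw

/-- The recursion behind the eigenvalues: `B_{m+1}` intertwines the shuffling operators of
`H_{m+1}` with those of `H_m` and the Jucys–Murphy element `Z_{m+1}`. -/
theorem B_mul_shuffleProd (hq : q ≠ 0) {m : ℕ} (hm : m < n) (k : ℕ) :
    B F q n (m + 1) * shuffleProd F q n (m + 1) (k + 1) =
      (q ^ (k + 1) • shuffleProd F q n m (k + 1) +
        (qInt q (k + 1) * (q ^ k)⁻¹) • ((jm F q n (m + 1) - qInt q k • 1) *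
          shuffleProd F q n m k)) * B F q n (m + 1) := by
  induction k generalizing m with
  | zero =>
    have h := T_mul_B_mul_B (R := F) (q := q) hm
    have h0 : shuffleProd F q n m 1 = Bstar F q n m * B F q n m := by
      cases m <;> simp [shuffleProd, Bstar_zero, shuffleProd_zero_right]
    rw [shuffleProd_succ_succ, shuffleProd_zero_right, mul_one, ← mul_assoc, B_mul_Bstar, zero_add,
      h0, qInt_zero]
    rw [add_mul, mul_assoc _ (T F q n m), mul_assoc (Bstar F q n m), mul_assoc (T F q n m), h]
    simp [qInt, add_mul, mul_assoc, add_comm]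
  | succ k ih =>
    cases m with
    | zero => simp [shuffleProd]
    | succ m =>
      have ih := ih (m := m) (by omega)
      have h := T_mul_B_mul_B (R := F) (q := q) hm
      set BB := B F q n (m + 1) * B F q n (m + 1 + 1) with hBB
      have hD (l) : T F q n (m + 1) * (shuffleProd F q n m l * BB) =
          q • (shuffleProd F q n m l * BB) := by
        rw [← mul_assoc, (T_comm_shuffleProd (by omega) l).eq, mul_assoc, h, mul_smul_comm]
      have hZ := T_mul_jm_mul (k := k) hq (hD k)
      have hc := (Bstar_comm_jm (R := F) (q := q) (show m + 1 < m + 1 + 1 by omega) hm).eq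
      have hS (l) : Bstar F q n (m + 1) * (shuffleProd F q n m l * BB) =
          shuffleProd F q n (m + 1) (l + 1) * B F q n (m + 1 + 1) := by
        rw [shuffleProd_succ_succ, hBB]; simp only [mul_assoc]
      calc _ = jm F q n (m + 1 + 1) * (shuffleProd F q n (m + 1) (k + 1) * B F q n (m + 1 + 1)) +
            Bstar F q n (m + 1) * (T F q n (m + 1) *
              ((B F q n (m + 1) * shuffleProd F q n (m + 1) (k + 1)) * B F q n (m + 1 + 1))) := by
            rw [shuffleProd_succ_succ (m + 1), ← mul_assoc, ← mul_assoc, B_mul_Bstar]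
            noncomm_ring
        _ = jm F q n (m + 1 + 1) * (shuffleProd F q n (m + 1) (k + 1) * B F q n (m + 1 + 1)) +
            Bstar F q n (m + 1) * (q ^ (k + 1) •
                (T F q n (m + 1) * (shuffleProd F q n m (k + 1) * BB)) +
              (qInt q (k + 1) * (q ^ k)⁻¹) • (T F q n (m + 1) *
                ((jm F q n (m + 1) - qInt q k • 1) * (shuffleProd F q n m k * BB)))) := by
            rw [ih, mul_assoc _ (B F q n (m + 1)), ← hBB, add_mul]
            simp only [smul_mul_assoc, mul_add, mul_smul_comm, mul_assoc]
        _ = _ := by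
            rw [hD, hZ]
            have h2 : Bstar F q n (m + 1) * ((jm F q n (m + 1 + 1) - qInt q (k + 2) • 1) *
                (shuffleProd F q n m k * BB)) = (jm F q n (m + 1 + 1) - qInt q (k + 2) • 1) *
                (shuffleProd F q n (m + 1) (k + 1) * B F q n (m + 1 + 1)) := by
              rw [← hS, sub_mul, mul_sub, ← mul_assoc, hc, mul_assoc, sub_mul]
              simp
            simp only [mul_add, mul_smul_comm, hS, h2]
            have e : qInt q (k + 2) = q ^ (k + 1) + qInt q (k + 1) := qInt_succ q (k + 1)
            simp only [add_mul, sub_mul, smul_mul_assoc, one_mul, mul_assoc]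
            rw [e]
            match_scalars <;> field_simp <;> ring

end Recursion

/-! ### Divisibility by the `q`-factorial -/

section Divisibility

variable (R : Type*) [CommRing R] (q : R) (n : ℕ)

/-- The product `T_{i+l-1} ⋯ T_{i+1} T_i` of `l` generators with descending indices. -/
def desc (i : ℕ) : ℕ → Hecke R q n
  | 0 => 1
  | l + 1 => T R q n (i + l) * desc i l

/-- `∑_{l < k} T_{p+l-1} ⋯ T_p`, the sum over the minimal left coset representatives of
`𝔖_{k-1}` in `𝔖_k` for the `k` positions from `p` on. -/
def descSum (p k : ℕ) : Hecke R q n := ∑ l ∈ Finset.range k, desc R q n p l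

/-- For `p ≥ 1`, the sum of `T_d` over the minimal left coset representatives `d` of
`𝔖_{p-1} × 𝔖_k` in `𝔖_{p-1+k}`, generated by the recursion according to whether `d` fixes the
last point. The value `0` at `p = 0` starts the recursion. -/
def cosetSum : ℕ → ℕ → Hecke R q n
  | 0, _ => 0
  | _ + 1, 0 => 1
  | p + 1, k + 1 => cosetSum (p + 1) k + cosetSum p (k + 1) * desc R q n p (k + 1)

variable {R q n}

theorem T_comm_desc {i j : ℕ} (h : j + 1 < i) (l : ℕ) :
    Commute (T R q n j) (desc R q n i l) := by
  induction l with
  | zero => exact Commute.one_right _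
  | succ l ih => exact Commute.mul_right (T_comm (by omega)) ih

theorem T_comm_desc_of_gt {i j l : ℕ} (h : i + l < j) :
    Commute (T R q n j) (desc R q n i l) := by
  induction l with
  | zero => exact Commute.one_right _
  | succ l ih => exact Commute.mul_right (T_comm (by omega)).symm (ih (by omega))

theorem Bstar_comm_desc {i m : ℕ} (h : m < i) (l : ℕ) :
    Commute (Bstar R q n m) (desc R q n i l) := by
  induction l with
  | zero => exact Commute.one_right _
  | succ l ih => exact Commute.mul_right (T_comm_Bstar (by omega)).symm ih

theorem desc_mul_T (i l : ℕ) : desc R q n (i + 1) l * T R q n i = desc R q n i (l + 1) := by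
  induction l with
  | zero => simp [desc]
  | succ l ih =>
    rw [desc, mul_assoc, ih, desc, desc, desc, show i + 1 + l = i + (l + 1) by omega]

/-- Conjugation by a descending product shifts the indices of generators. -/
theorem T_mul_desc {i j l : ℕ} (hi : i ≤ j) (h : j + 1 < i + l) :
    T R q n j * desc R q n i l = desc R q n i l * T R q n (j + 1) := by
  induction l with
  | zero => omega
  | succ l ih =>
    obtain h' | h' := Nat.lt_or_ge (j + 1) (i + l)
    · rw [desc, ← mul_assoc, T_comm (by omega), mul_assoc, ih h', mul_assoc]
    · obtain ⟨l, rfl⟩ : ∃ l', l = l' + 1 := ⟨l - 1, by omega⟩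
      obtain rfl : j = i + l := by omega
      rw [desc, desc, show i + (l + 1) = i + l + 1 by omega, ← mul_assoc, ← mul_assoc, T_braid,
        mul_assoc, (T_comm_desc_of_gt (show i + l < i + l + 1 by omega)).eq]
      simp only [mul_assoc]

theorem desc_mul_desc {p l k : ℕ} (h : l < k) :
    desc R q n p l * desc R q n p k = desc R q n p k * desc R q n (p + 1) l := by
  induction l with
  | zero => simp [desc]
  | succ l ih =>
    rw [desc, desc, mul_assoc, ih (by omega), ← mul_assoc, T_mul_desc (by omega) (by omega),
      mul_assoc, show p + l + 1 = p + 1 + l by omega]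

theorem descSum_mul_desc (p k : ℕ) :
    descSum R q n p k * desc R q n p k = desc R q n p k * descSum R q n (p + 1) k := by
  rw [descSum, descSum, Finset.sum_mul, Finset.mul_sum]
  exact Finset.sum_congr rfl fun l hl => desc_mul_desc (Finset.mem_range.mp hl)

/-- The coset representatives of `𝔖_p × 𝔖_k` times those of `𝔖_{p-1}` in `𝔖_p` are the coset
representatives of `𝔖_{p-1} × 𝔖_{k+1}` times those of `𝔖_k` in `𝔖_{k+1}`. -/
theorem cosetSum_mul_Bstar (p k : ℕ) :
    cosetSum R q n (p + 1) k * Bstar R q n p =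
      cosetSum R q n p (k + 1) * descSum R q n p (k + 1) := by
  induction p generalizing k with
  | zero => simp [cosetSum, Bstar_zero]
  | succ p ih =>
    induction k with
    | zero =>
      have h := ih 0
      simp only [cosetSum, descSum, Finset.sum_range_one, desc, mul_one, one_mul, zero_add,
        add_zero] at h ⊢
      rw [Bstar_succ, h]
    | succ k ihk =>
      have h1 : cosetSum R q n (p + 2) (k + 1) = cosetSum R q n (p + 2) k +
        cosetSum R q n (p + 1) (k + 1) * desc R q n (p + 1) (k + 1) := by rw [cosetSum]
      have h2 : cosetSum R q n (p + 1) (k + 2) = cosetSum R q n (p + 1) (k + 1) +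
        cosetSum R q n p (k + 2) * desc R q n p (k + 2) := by rw [cosetSum]
      have h3 : descSum R q n (p + 1) (k + 2) =
          descSum R q n (p + 1) (k + 1) + desc R q n (p + 1) (k + 1) :=
        Finset.sum_range_succ _ _
      have h4 := descSum_mul_desc (R := R) (q := q) (n := n) p (k + 2)
      calc _ = cosetSum R q n (p + 1 + 1) k * Bstar R q n (p + 1) +
            cosetSum R q n (p + 1) (k + 1) * desc R q n (p + 1) (k + 1) +
            cosetSum R q n (p + 1) (k + 1) *
              (desc R q n (p + 1) (k + 1) * Bstar R q n p) * T R q n p := by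
            rw [h1, add_mul, Bstar_succ]; noncomm_ring
        _ = cosetSum R q n (p + 1) (k + 1) * descSum R q n (p + 1) (k + 1) +
            cosetSum R q n (p + 1) (k + 1) * desc R q n (p + 1) (k + 1) +
            cosetSum R q n (p + 1) (k + 1) * Bstar R q n p *
              (desc R q n (p + 1) (k + 1) * T R q n p) := by
            rw [ihk, ← (Bstar_comm_desc (by omega) (k + 1)).eq]; simp only [mul_assoc]
        _ = cosetSum R q n (p + 1) (k + 1) * descSum R q n (p + 1) (k + 2) +
            cosetSum R q n p (k + 2) * (descSum R q n p (k + 2) * desc R q n p (k + 2)) := by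
            rw [ih, desc_mul_T, h3]; noncomm_ring
        _ = _ := by rw [h4, h2]; noncomm_ring

theorem kRandomToBottom_succ (k : ℕ) :
    kRandomToBottom R q n (k + 1) = kRandomToBottom R q n k * Bstar R q n (n - k) := by
  simp [kRandomToBottom, List.range_succ]

theorem kBottomToRandom_succ (k : ℕ) :
    kBottomToRandom R q n (k + 1) = B R q n (n - k) * kBottomToRandom R q n k := by
  simp [kBottomToRandom, List.range_succ]

theorem T_mul_kBottomToRandom {i k : ℕ} (hk : k ≤ n) (hi : n < i + k) (hn : i < n) :
    T R q n i * kBottomToRandom R q n k = q • kBottomToRandom R q n k := by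
  induction k with
  | zero => omega
  | succ k ih =>
    rw [kBottomToRandom_succ]
    obtain h | h := Nat.lt_or_ge n (i + k)
    · rw [← mul_assoc, (T_comm_B (by omega)).eq, mul_assoc, ih (by omega) h, mul_smul_comm]
    · obtain ⟨k, rfl⟩ : ∃ k', k = k' + 1 := ⟨k - 1, by omega⟩
      have h := T_mul_B_mul_B (R := R) (q := q) hn
      rw [kBottomToRandom_succ, show n - (k + 1) = i by omega, show n - k = i + 1 by omega,
        ← mul_assoc (B R q n i), ← mul_assoc, h, smul_mul_assoc]

theorem desc_mul_of_symm {p l : ℕ} {v : Hecke R q n}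
    (h : ∀ i, p ≤ i → i < p + l → T R q n i * v = q • v) : desc R q n p l * v = q ^ l • v := by
  induction l with
  | zero => simp [desc]
  | succ l ih =>
    rw [desc, mul_assoc, ih fun i h1 h2 => h i h1 (by omega), mul_smul_comm,
      h _ (by omega) (by omega), smul_smul, pow_succ]

/-- `B*_{n,k}` factors through the symmetrizer `x` of the last `k` positions. -/
theorem exists_kRandomToBottom_eq {k : ℕ} (hk : k ≤ n) :
    ∃ x : Hecke R q n, (∀ j, j + k < n → Commute (T R q n j) x) ∧
      kRandomToBottom R q n k = cosetSum R q n (n - k + 1) k * x ∧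
      ∀ v : Hecke R q n, (∀ i, n < i + k → i < n → T R q n i * v = q • v) →
        x * v = qFactorial q k • v := by
  induction k with
  | zero =>
    exact ⟨1, fun _ _ => Commute.one_right _, by simp [kRandomToBottom, cosetSum],
      fun v _ => by simp [qFactorial]⟩
  | succ k ih =>
    obtain ⟨x, h1, h2, h3⟩ := ih (by omega)
    obtain ⟨p, hp⟩ : ∃ p, n = p + 1 + k := ⟨n - k - 1, by omega⟩
    have hB (m : ℕ) (hm : m + k ≤ n) : Commute (Bstar R q n m) x := by
      induction m with
      | zero => simp [Bstar_zero]
      | succ m ih =>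
        rw [Bstar_succ]
        exact (Commute.one_left _).add_left ((ih (by omega)).mul_left (h1 m (by omega)))
    refine ⟨descSum R q n (p + 1) (k + 1) * x, fun j hj => ?_, ?_, fun v hv => ?_⟩
    · exact (Commute.sum_right _ _ _ fun l _ => T_comm_desc (by omega) l).mul_right
        (h1 j (by omega))
    · rw [kRandomToBottom_succ, h2, show n - k = p + 1 by omega,
        show n - (k + 1) + 1 = p + 1 by omega, mul_assoc, ← (hB (p + 1) (by omega)).eq,
        ← mul_assoc, cosetSum_mul_Bstar, mul_assoc]
    · rw [mul_assoc, h3 v fun i hi => hv i (by omega), mul_smul_comm, qFactorial_succ, mul_smul]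
      congr 1
      rw [descSum, Finset.sum_mul, qInt, Finset.sum_smul]
      refine Finset.sum_congr rfl fun l hl => desc_mul_of_symm fun i h4 h5 => hv i ?_ ?_
      all_goals have := Finset.mem_range.mp hl
      all_goals omega

/-- The `q`-factorial `[k]!_q` divides `B*_{n,k} B_{n,k}`. For `k > n` this product vanishes because
of the factor `B*_0 = 0`. -/
theorem exists_qFactorial_smul_eq (k : ℕ) :
    ∃ r : Hecke R q n, qFactorial q k • r = kRandomToBottom R q n k * kBottomToRandom R q n k := by
  obtain hk | hk := Nat.lt_or_ge n k
  · refine ⟨0, ?_⟩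
    have : kRandomToBottom R q n k = 0 := by
      induction k, hk using Nat.le_induction with
      | base => rw [kRandomToBottom_succ, Nat.sub_self, Bstar_zero, mul_zero]
      | succ k _ ih => rw [kRandomToBottom_succ, ih, zero_mul]
    rw [this, zero_mul, smul_zero]
  · obtain ⟨x, -, h2, h3⟩ := exists_kRandomToBottom_eq (R := R) (q := q) hk
    refine ⟨cosetSum R q n (n - k + 1) k * kBottomToRandom R q n k, ?_⟩
    rw [h2, mul_assoc, h3 _ fun i hi hn => T_mul_kBottomToRandom hk hi hn, mul_smul_comm]

theorem shuffleProd_eq (m k : ℕ) :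
    shuffleProd R q n m k = ((List.range k).map fun j => Bstar R q n (m - j)).prod *
      ((List.range k).reverse.map fun j => B R q n (m - j)).prod := by
  induction k generalizing m with
  | zero => simp [shuffleProd_zero_right]
  | succ k ih =>
    rw [List.range_succ_eq_map]
    cases m with
    | zero => simp [shuffleProd, Bstar_zero]
    | succ m =>
      rw [shuffleProd_succ_succ, ih]
      simp [mul_assoc, Function.comp_def]

theorem shuffleProd_self (k : ℕ) :
    shuffleProd R q n n k = kRandomToBottom R q n k * kBottomToRandom R q n k :=
  shuffleProd_eq n k

end Divisibility

/-! ### The affine Hecke algebra of rank two -/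

section Affine

variable {F A : Type*} [Field F] [Ring A] [Algebra F A] {q : F}

theorem aeval_mul_eq_of_mul_eq {x y w : A} (hxy : Commute x y) (h : y * w = x * w) (f : F[X]) :
    aeval y f * w = aeval x f * w := by
  have hk (k : ℕ) : y ^ k * w = x ^ k * w := by
    induction k with
    | zero => simp
    | succ k ih => rw [pow_succ', mul_assoc, ih, ← mul_assoc, ← (hxy.pow_left k).eq, mul_assoc, h,
        ← mul_assoc, ← pow_succ]
  induction f using Polynomial.induction_on' with
  | add f g hf hg => simp [add_mul, hf, hg]
  | monomial k a => simp [aeval_monomial, mul_assoc, hk]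

theorem commute_aeval {x y : A} (h : Commute x y) (f : F[X]) : Commute (aeval x f) y :=
  Polynomial.induction_on' (motive := fun f => Commute (aeval x f) y) f
    (fun f g hf hg => by rw [map_add]; exact hf.add_left hg)
    fun k a => by
      rw [aeval_monomial]
      exact Commute.mul_left (Algebra.commutes a y) (h.pow_left k)

/-- The data of the affine Hecke algebra of rank two: commuting elements `x`, `y` and a generator
`t` with `t x t = q y`. -/
structure IsAffinePair (q : F) (t x y : A) : Prop where
  ne_zero : q ≠ 0
  comm : Commute x y
  quadratic : t * t = (q - 1) • t + q • (1 : A)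
  conj : t * x * t = q • y

namespace IsAffinePair

variable {t x y : A} (h : IsAffinePair q t x y)
include h

theorem t_mul_x : t * x = y * t - (q - 1) • y := by
  have h1 := h.conj
  have h2 := h.quadratic
  have h3 : q • (t * x - (y * t - (q - 1) • y)) = 0 := by
    linear_combination (norm := (simp only [mul_add, smul_sub, sub_mul, mul_sub,
      sub_smul, smul_smul, smul_mul_assoc, mul_smul_comm, mul_assoc, mul_one]; module))
      h1 * t - t * x * h2 - (q - 1) • h1
  exact sub_eq_zero.mp ((smul_eq_zero_iff_right h.ne_zero).mp h3)

theorem t_mul_y : t * y = x * t + (q - 1) • y := by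
  have h1 := h.conj
  have h2 := h.quadratic
  have h3 : q • (t * y - (x * t + (q - 1) • y)) = 0 := by
    linear_combination (norm := (simp only [add_mul, sub_mul, smul_sub, smul_add,
      sub_smul, smul_smul, smul_mul_assoc, mul_smul_comm, mul_assoc, one_mul]; module))
      h2 * (x * t) + (q - 1) • h1 - t * h1
  exact sub_eq_zero.mp ((smul_eq_zero_iff_right h.ne_zero).mp h3)

/-- The Bernstein relation, cleared of its denominator. -/
theorem bernstein (f : F[X]) :
    (y - x) * (t * aeval x f) =
      (y - x) * (aeval y f * t) - (q - 1) • (y * (aeval y f - aeval x f)) := by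
  have hk (k : ℕ) : (y - x) * (t * x ^ k) =
      (y - x) * (y ^ k * t) - (q - 1) • (y * (y ^ k - x ^ k)) := by
    induction k with
    | zero => simp
    | succ k ih =>
      have h1 : y ^ k * x = x * y ^ k := (h.comm.pow_right k).eq.symm
      have h2 := h.t_mul_x
      have h3 := h.comm.eq
      rw [pow_succ, pow_succ]
      generalize x ^ k = xk at *
      have h4 : y ^ k * y = y * y ^ k := (Commute.refl y).pow_left k
      generalize y ^ k = yk at *
      linear_combination (norm := (simp only [mul_sub, sub_mul, smul_sub,
        sub_smul, smul_mul_assoc, mul_smul_comm, mul_assoc]; module))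
        ih * x + (y - x) * yk * h2 - (q - 1) • (y * h1) + (q - 1) • (h3 * yk) + (q - 1) • (x * h4)
  induction f using Polynomial.induction_on' with
  | add f g hf hg =>
    simp only [map_add, mul_add, add_mul, mul_sub, smul_add, smul_sub] at hf hg ⊢
    linear_combination (norm := module) hf + hg
  | monomial k a =>
    have := hk k
    simp only [aeval_monomial, ← Algebra.smul_def, mul_smul_comm, smul_mul_assoc,
      ← smul_sub, this, smul_comm (q - 1) a]

/-- If `u` is symmetric for `t`, a polynomial that annihilates `x` on `u` yields one that
annihilates `y` on `u`. -/
theorem aeval_mul_of_symm {u : A} {f : F[X]} (hu : t * u = q • u) (hf : aeval x f * u = 0) :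
    aeval (q⁻¹ • y) f * (aeval y f * u) = 0 := by
  have h1 := congr($(h.bernstein f) * u)
  have hc : aeval y f * x = x * aeval y f := (commute_aeval h.comm.symm f).eq
  have h2 : y * (aeval y f * u) = q • x * (aeval y f * u) := by
    generalize aeval y f = fy at *
    generalize aeval x f = fx at *
    linear_combination (norm := (simp only [mul_sub, sub_mul, smul_sub,
        sub_smul, smul_mul_assoc, mul_smul_comm, mul_assoc, mul_zero]; module))
      (y - x) * t * hf - h1 - (y - x) * fy * hu - (q - 1) • y * hf
  rw [aeval_mul_eq_of_mul_eq (x := x) (h.comm.symm.smul_left _).symm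
    (by rw [smul_mul_assoc, h2, smul_mul_assoc, smul_smul, inv_mul_cancel₀ h.ne_zero, one_smul]),
    ← mul_assoc, (commute_aeval (commute_aeval h.comm.symm f).symm f).eq, mul_assoc, hf, mul_zero]

/-- A polynomial that annihilates `x` yields one that annihilates `y`. -/
theorem aeval_eq_zero {f : F[X]} (hf : aeval x f = 0) :
    aeval (q • y) f * (aeval (q⁻¹ • y) f * aeval y f) = 0 := by
  have hx := h.t_mul_x
  have hy := h.t_mul_y
  have hq := h.quadratic
  have hxy : x * y = y * x := h.comm
  have hcx : aeval y f * x = x * aeval y f := (commute_aeval h.comm.symm f).eq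
  have hcy : aeval y f * y = y * aeval y f := (commute_aeval (Commute.refl y) f).eq
  -- The intertwiner `(y - x) t - (q - 1) y` is killed by `f(y)` and has a square in `F[x, y]`.
  have h1 : aeval y f * ((y - x) * t - (q - 1) • y) = 0 := by
    have h1 := h.bernstein f
    rw [hf] at h1
    generalize aeval y f = fy at *
    linear_combination (norm := (simp only [mul_sub, sub_mul, sub_smul, smul_sub,
        mul_smul_comm, mul_assoc, mul_zero]; module))
      hcy * t - hcx * t - (q - 1) • hcy - h1
  have h2 : ((y - x) * t - (q - 1) • y) * ((y - x) * t - (q - 1) • y) =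
      (q • x - y) * (q • y - x) := by
    linear_combination (norm := (simp only [mul_sub, sub_mul, sub_smul, smul_sub, mul_add, add_mul,
        smul_mul_assoc, mul_smul_comm, mul_assoc, mul_one]; module))
      (y - x) * hy * t - (y - x) * hx * t - (y - x) * (y - x) * hq - (q - 1) • ((y - x) * hy)
        - (q - 1) • (hxy * t) - (q - 1) • hxy
  have hc1 : Commute (aeval y f) (q • x - y) :=
    (Commute.smul_right hcx q).sub_right hcy
  have hc2 (g : A) (hx : Commute g x) (hy : Commute g y) : Commute g (q • y - x) :=
    (hy.smul_right q).sub_right hx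
  have h3 : (q⁻¹ • y) * ((q • y - x) * aeval y f) = x * ((q • y - x) * aeval y f) := by
    have h3 : (q • x - y) * ((q • y - x) * aeval y f) = 0 := by
      rw [← (hc2 _ hcx hcy).eq, ← mul_assoc, ← hc1.eq, mul_assoc, ← h2, ← mul_assoc, h1, zero_mul]
    rw [sub_mul, sub_eq_zero] at h3
    rw [smul_mul_assoc, ← h3, smul_mul_assoc, smul_smul, inv_mul_cancel₀ h.ne_zero, one_smul]
  have h4 : aeval (q⁻¹ • y) f * ((q • y - x) * aeval y f) = 0 := by
    rw [aeval_mul_eq_of_mul_eq (x := x) (h.comm.symm.smul_left _).symm h3, hf, zero_mul]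
  have h5 : (q • y) * (aeval (q⁻¹ • y) f * aeval y f) =
      x * (aeval (q⁻¹ • y) f * aeval y f) := by
    rw [← mul_assoc, (hc2 _ (commute_aeval (h.comm.symm.smul_left _) f)
      (commute_aeval ((Commute.refl y).smul_left _) f)).eq, mul_assoc] at h4
    rwa [sub_mul, sub_eq_zero] at h4
  rw [aeval_mul_eq_of_mul_eq (x := x) (h.comm.symm.smul_left _).symm h5, hf, zero_mul]

end IsAffinePair

end Affine

/-! ### Eigenvalues at a generic parameter -/

section Spectrum

variable {F : Type*} [Field F] (q : F) (n : ℕ)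

/-- The multiplicative Jucys–Murphy elements `L_m = q^{-m} (1 + (q - 1) Z_m)`. -/
def jmMul (m : ℕ) : Hecke F q n := (q ^ m)⁻¹ • (1 + (q - 1) • jm F q n m)

/-- A nonzero polynomial all of whose roots are powers `q ^ d` with `c ≤ d`. -/
def HasPowerRoots (c : ℤ) (f : F[X]) : Prop :=
  f ≠ 0 ∧ ∀ x, f.IsRoot x → ∃ d : ℤ, c ≤ d ∧ x = q ^ d

variable {q n}

theorem HasPowerRoots.mul {c : ℤ} {f g : F[X]} (hf : HasPowerRoots q c f)
    (hg : HasPowerRoots q c g) : HasPowerRoots q c (f * g) :=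
  ⟨mul_ne_zero hf.1 hg.1, fun x hx => (root_mul.mp hx).elim (hf.2 x) (hg.2 x)⟩

theorem HasPowerRoots.mono {c c' : ℤ} (h : c' ≤ c) {f : F[X]} (hf : HasPowerRoots q c f) :
    HasPowerRoots q c' f :=
  ⟨hf.1, fun x hx => (hf.2 x hx).imp fun _ hd => ⟨h.trans hd.1, hd.2⟩⟩

theorem HasPowerRoots.comp_scale (hq : q ≠ 0) {c : ℤ} {f : F[X]} (hf : HasPowerRoots q c f)
    (e : ℤ) : HasPowerRoots q (c + e) (f.comp (C (q ^ (-e)) * X)) := by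
  have h0 : q ^ (-e) ≠ 0 := zpow_ne_zero _ hq
  refine ⟨(comp_C_mul_X_eq_zero_iff (mem_nonZeroDivisors_of_ne_zero h0)).not.mpr hf.1,
    fun x hx => ?_⟩
  rw [IsRoot.def, eval_comp, eval_mul, eval_C, eval_X] at hx
  obtain ⟨d, hd, h⟩ := hf.2 _ hx
  refine ⟨d + e, by omega, ?_⟩
  rw [zpow_add₀ hq, ← h, mul_right_comm, ← zpow_add₀ hq]
  simp

theorem aeval_comp_scale {A : Type*} [Ring A] [Algebra F A] (f : F[X]) (a : F) (y : A) :
    aeval y (f.comp (C a * X)) = aeval (a • y) f := by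
  rw [aeval_comp, map_mul, aeval_C, aeval_X, Algebra.smul_def]

theorem isAffinePair_jmMul (hq : q ≠ 0) {m : ℕ} (h1 : 1 ≤ m) (hn : m < n) :
    IsAffinePair q (T F q n m) (jmMul q n m) (jmMul q n (m + 1)) where
  ne_zero := hq
  comm := by
    have h := jm_comm (R := F) (q := q) hn.le hn
    exact (((Commute.one_left _).add_left (((Commute.one_right _).add_right
      (h.smul_right _)).smul_left _)).smul_right _).smul_left _
  quadratic := T_mul_self h1 hn
  conj := by
    have h := T_mul_self (R := F) (q := q) h1 hn
    rw [jmMul, jmMul, jm_succ]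
    generalize T F q n m = t at *
    generalize jm F q n m = z at *
    have h2 : q * (q ^ (m + 1))⁻¹ = (q ^ m)⁻¹ := by rw [pow_succ]; field_simp
    rw [smul_smul, h2]
    linear_combination (norm := (simp only [mul_add, add_mul, smul_add, mul_one,
        smul_mul_assoc, mul_smul_comm]; module)) (q ^ m)⁻¹ • h

/-- The eigenvalues of `L_m` are powers `q ^ c` with `c > -m`. -/
theorem exists_aeval_jmMul_eq_zero (hq : q ≠ 0) {m : ℕ} (h1 : 1 ≤ m) (hn : m ≤ n) :
    ∃ f : F[X], HasPowerRoots q (1 - m) f ∧ aeval (jmMul q n m) f = 0 := by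
  induction m, h1 using Nat.le_induction with
  | base =>
    refine ⟨X - C 1, ⟨X_sub_C_ne_zero 1, fun x hx => ⟨0, by simp, ?_⟩⟩, ?_⟩
    · simpa using (root_X_sub_C.mp hx).symm
    · have : jmMul q n 1 = 1 := by
        rw [jmMul, jm_succ, T_eq_zero (Or.inl rfl)]
        simp only [add_zero, zero_mul, sub_smul, one_smul, pow_one]
        rw [add_sub_cancel, smul_smul, inv_mul_cancel₀ hq, one_smul]
      simp [this]
  | succ m h1 ih =>
    obtain ⟨f, hf, h0⟩ := ih (by omega)
    refine ⟨f.comp (C (q ^ (- -1 : ℤ)) * X) * (f.comp (C (q ^ (-1 : ℤ)) * X) * f),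
      ((hf.comp_scale hq (-1)).mono ?_).mul (((hf.comp_scale hq 1).mono ?_).mul (hf.mono ?_)), ?_⟩
    · push_cast; omega
    · push_cast; omega
    · push_cast; omega
    · rw [map_mul, map_mul, aeval_comp_scale, aeval_comp_scale]
      simpa using (isAffinePair_jmMul hq h1 hn).aeval_eq_zero h0

/-- If `T_i u = q u` for all `i > j`, the eigenvalues on `u` of all `L_m` with `m > j` are subject
to the same lower bound as those of `L_{j+1}`. -/
theorem exists_aeval_jmMul_mul_eq_zero (hq : q ≠ 0) {j m : ℕ} (hj : j < m) (hn : m ≤ n)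
    {u : Hecke F q n} (hu : ∀ i, j < i → i < n → T F q n i * u = q • u) :
    ∃ f : F[X], HasPowerRoots q (-j) f ∧ aeval (jmMul q n m) f * u = 0 := by
  induction m, hj using Nat.le_induction with
  | base =>
    obtain ⟨f, hf, h0⟩ := exists_aeval_jmMul_eq_zero (n := n) hq (show 1 ≤ j + 1 by omega) hn
    exact ⟨f, hf.mono (by push_cast; omega), by rw [h0, zero_mul]⟩
  | succ m hm ih =>
    obtain ⟨f, hf, h0⟩ := ih (by omega)
    refine ⟨f.comp (C (q ^ (-1 : ℤ)) * X) * f, ((hf.comp_scale hq 1).mono (by omega)).mul hf, ?_⟩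
    rw [map_mul, aeval_comp_scale, mul_assoc]
    simpa using (isAffinePair_jmMul hq (by omega) hn).aeval_mul_of_symm (hu m hm hn) h0

/-- A common eigenvector of the Jucys–Murphy elements that satisfies all linear relations of `u`
with coefficients in their centralizer. -/
theorem exists_common_eigenvector [IsAlgClosed F] [FiniteDimensional F (Hecke F q n)]
    {u : Hecke F q n} (hu : u ≠ 0) {l : ℕ} (hl : l ≤ n) :
    ∃ w : Hecke F q n, w ≠ 0 ∧
      (∀ a, (∀ i ≤ n, Commute a (jm F q n i)) → a * u = 0 → a * w = 0) ∧
      ∀ i ≤ l, ∃ z : F, jm F q n i * w = z • w := by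
  induction l with
  | zero =>
    exact ⟨u, hu, fun a _ h => h, fun i hi => ⟨0, by
      obtain rfl : i = 0 := by omega
      simp [jm]⟩⟩
  | succ l ih =>
    obtain ⟨w, hw, h1, h2⟩ := ih (by omega)
    choose! z hz using h2
    -- The common eigenvectors of `Z_1, …, Z_l` with the relations of `u` form a space that is
    -- stable under `Z_{l+1}`.
    let N : Submodule F (Hecke F q n) :=
      { carrier := {v | (∀ a, (∀ i ≤ n, Commute a (jm F q n i)) → a * u = 0 → a * v = 0) ∧
          ∀ i ≤ l, jm F q n i * v = z i • v}
        add_mem' := fun {a b} ha hb => ⟨fun c h h' => by rw [mul_add, ha.1 c h h', hb.1 c h h',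
          add_zero], fun i hi => by rw [mul_add, ha.2 i hi, hb.2 i hi, smul_add]⟩
        zero_mem' := ⟨fun c _ _ => mul_zero c, fun i _ => by rw [mul_zero, smul_zero]⟩
        smul_mem' := fun c v hv => ⟨fun a h h' => by rw [mul_smul_comm, hv.1 a h h', smul_zero],
          fun i hi => by rw [mul_smul_comm, hv.2 i hi, smul_comm]⟩ }
    have hN : ∀ v ∈ N, LinearMap.mulLeft F (jm F q n (l + 1)) v ∈ N := by
      rintro v ⟨h3, h4⟩
      refine ⟨fun a h h' => ?_, fun i hi => ?_⟩
      · rw [LinearMap.mulLeft_apply, ← mul_assoc, (h (l + 1) hl).eq, mul_assoc, h3 a h h', mul_zero]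
      · rw [LinearMap.mulLeft_apply, ← mul_assoc, (jm_comm (by omega) hl).eq, mul_assoc, h4 i hi,
          mul_smul_comm]
    have : Nontrivial N := ⟨⟨⟨w, h1, hz⟩, 0, fun h => hw (congrArg Subtype.val h)⟩⟩
    obtain ⟨c, hc⟩ :=
      Module.End.exists_eigenvalue ((LinearMap.mulLeft F (jm F q n (l + 1))).restrict hN)
    obtain ⟨⟨v, h3, h4⟩, hv⟩ := hc.exists_hasEigenvector
    refine ⟨v, fun h => hv.2 (Subtype.ext h), h3, fun i hi => ?_⟩
    obtain hi | rfl := Nat.le_succ_iff.mp hi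
    · exact ⟨_, h4 i hi⟩
    · exact ⟨c, congrArg Subtype.val hv.apply_eq_smul⟩

/-- The product `B_{j+1} B_{j+2} ⋯ B_{j+i}`. -/
def ascB (F : Type*) [Field F] (q : F) (n j : ℕ) : ℕ → Hecke F q n
  | 0 => 1
  | i + 1 => ascB F q n j i * B F q n (j + i + 1)

theorem ascB_comm_jm {j i l : ℕ} (h : j + i < l) (hl : l ≤ n) :
    Commute (ascB F q n j i) (jm F q n l) := by
  induction i with
  | zero => exact Commute.one_left _
  | succ i ih => exact (ih (by omega)).mul_left (B_comm_jm (by omega) hl)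

theorem T_comm_ascB {j i s : ℕ} (h : j + i < s) : Commute (T F q n s) (ascB F q n j i) := by
  induction i with
  | zero => exact Commute.one_right _
  | succ i ih => exact Commute.mul_right (ih (by omega)) (T_comm_B (by omega))

theorem T_mul_ascB {j i s : ℕ} (hj : j < s) (hi : s < j + i) (hn : j + i ≤ n) :
    T F q n s * ascB F q n j i = q • ascB F q n j i := by
  induction i with
  | zero => omega
  | succ i ih =>
    obtain h | h := Nat.lt_or_ge s (j + i)
    · rw [ascB, ← mul_assoc, ih h (by omega), smul_mul_assoc]
    · obtain ⟨i, rfl⟩ : ∃ i', i = i' + 1 := ⟨i - 1, by omega⟩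
      obtain rfl : s = j + i + 1 := by omega
      rw [ascB, ascB, mul_assoc, ← mul_assoc, (T_comm_ascB (show j + i < j + i + 1 by omega)).eq,
        mul_assoc, show j + (i + 1) = j + i + 1 by rfl,
        T_mul_B_mul_B (by omega), mul_smul_comm]

/-- The action of the shuffling operators through the Jucys–Murphy elements `Z_{j+1}, …, Z_{j+i}`
on vectors lifted from the kernel of `B_j`. -/
def jmShuffle (F : Type*) [Field F] (q : F) (n j : ℕ) : ℕ → ℕ → Hecke F q n
  | _, 0 => 1
  | 0, _ + 1 => 0
  | i + 1, k + 1 => q ^ (k + 1) • jmShuffle F q n j i (k + 1) +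
      (qInt q (k + 1) * (q ^ k)⁻¹) •
        ((jm F q n (j + i + 1) - qInt q k • 1) * jmShuffle F q n j i k)

theorem jmShuffle_comm_jm {j i k l : ℕ} (hi : j + i ≤ n) (hl : l ≤ n) :
    Commute (jmShuffle F q n j i k) (jm F q n l) := by
  induction i generalizing k with
  | zero => cases k <;> simp [jmShuffle]
  | succ i ih =>
    cases k with
    | zero => simp [jmShuffle]
    | succ k =>
      exact ((ih (by omega)).smul_left _).add_left ((((jm_comm (by omega) hl).sub_left
        ((Commute.one_left _).smul_left _)).mul_left (ih (by omega))).smul_left _)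

/-- On vectors that `B_{j+1} ⋯ B_{j+i}` moves into the kernel of `B_j`, iterating the recursion
expresses the shuffling operators through Jucys–Murphy elements. -/
theorem ascB_mul_shuffleProd (hq : q ≠ 0) {j i k : ℕ} (hn : j + i ≤ n) {y : Hecke F q n}
    (hy : B F q n j * (ascB F q n j i * y) = 0) :
    ascB F q n j i * (shuffleProd F q n (j + i) k * y) =
      jmShuffle F q n j i k * (ascB F q n j i * y) := by
  induction i generalizing k y with
  | zero =>
    cases k with
    | zero => simp [jmShuffle, shuffleProd_zero_right, ascB]
    | succ k =>
      rw [ascB, one_mul] at hy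
      cases j with
      | zero => simp [jmShuffle, shuffleProd]
      | succ j => simp [jmShuffle, shuffleProd, ascB, mul_assoc, hy]
  | succ i ih =>
    cases k with
    | zero => simp [jmShuffle, shuffleProd_zero_right]
    | succ k =>
      have hy' : B F q n j * (ascB F q n j i * (B F q n (j + i + 1) * y)) = 0 := by
        rwa [ascB, mul_assoc] at hy
      have h1 := ih (k := k + 1) (by omega) hy'
      have h2 := ih (k := k) (by omega) hy'
      have hc := (ascB_comm_jm (F := F) (q := q) (show j + i < j + i + 1 by omega) hn).eq
      have hB := B_mul_shuffleProd hq (show j + i < n by omega) k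
      have hc' : ascB F q n j i * (jm F q n (j + i + 1) - qInt q k • 1) =
          (jm F q n (j + i + 1) - qInt q k • 1) * ascB F q n j i := by
        rw [mul_sub, sub_mul, hc]; simp
      calc _ = ascB F q n j i * (B F q n (j + i + 1) *
              shuffleProd F q n (j + i + 1) (k + 1) * y) := by
            rw [ascB]; simp only [mul_assoc]; rfl
        _ = q ^ (k + 1) • (ascB F q n j i * (shuffleProd F q n (j + i) (k + 1) *
              (B F q n (j + i + 1) * y))) + (qInt q (k + 1) * (q ^ k)⁻¹) •
              (ascB F q n j i * (jm F q n (j + i + 1) - qInt q k • 1) *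
                (shuffleProd F q n (j + i) k * (B F q n (j + i + 1) * y))) := by
            rw [hB]
            simp only [add_mul, mul_add, smul_mul_assoc, mul_smul_comm, mul_assoc]
        _ = _ := by
            rw [h1, hc', mul_assoc, h2, jmShuffle, ascB]
            simp only [add_mul, smul_mul_assoc, mul_assoc]

theorem B_mul_ascB (j i : ℕ) :
    B F q n (j + 1) * ascB F q n (j + 1) i = ascB F q n j (i + 1) := by
  induction i with
  | zero => simp [ascB]
  | succ i ih => rw [ascB, ← mul_assoc, ih, show j + 1 + i + 1 = j + (i + 1) + 1 by omega]; rfl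

/-- Every nonzero vector has a last nonzero image under the successive application of
`B_n, B_{n-1}, …`; the process stops since `B_0 = 0`. -/
theorem exists_ascB_mul_ne_zero {v : Hecke F q n} (hv : v ≠ 0) :
    ∃ j i, j + i = n ∧ ascB F q n j i * v ≠ 0 ∧ B F q n j * (ascB F q n j i * v) = 0 := by
  classical
  have h : ∃ j i, j + i = n ∧ ascB F q n j i * v ≠ 0 := ⟨n, 0, rfl, by simpa [ascB]⟩
  obtain ⟨i, hi, h1⟩ := Nat.find_spec h
  refine ⟨Nat.find h, i, hi, h1, ?_⟩
  by_contra h2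
  cases hj : Nat.find h with
  | zero => simp [hj, B_zero] at h2
  | succ j =>
    rw [hj] at h2 hi
    exact Nat.find_min h (show j < Nat.find h by omega)
      ⟨i + 1, by omega, by rwa [← B_mul_ascB, mul_assoc]⟩

theorem qInt_add (a b : ℕ) : qInt q (a + b) = qInt q a + q ^ a * qInt q b := by
  rw [qInt, qInt, qInt, Finset.sum_range_add, Finset.mul_sum]
  simp [pow_add]

/-- On a lift `u` of a vector in the kernel of `B_j`, common eigenvectors of the Jucys–Murphy
elements `Z_m`, `m > j`, have eigenvalues `[d]_q` with `d ≥ m - j`. -/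
theorem exists_jm_mul_eq (hq : q ≠ 0) (hq1 : q ≠ 1) {j m : ℕ} (hj : j < m) (hn : m ≤ n)
    {u w : Hecke F q n} (hu : ∀ i, j < i → i < n → T F q n i * u = q • u) (hw : w ≠ 0)
    (huw : ∀ a, (∀ i ≤ n, Commute a (jm F q n i)) → a * u = 0 → a * w = 0)
    {z : F} (hz : jm F q n m * w = z • w) :
    ∃ d : ℕ, m ≤ d + j ∧ jm F q n m * w = qInt q d • w := by
  obtain ⟨f, hf, h0⟩ := exists_aeval_jmMul_mul_eq_zero hq hj hn hu
  have h1 : aeval (jmMul q n m) f * w = 0 := huw _ (fun i hi => commute_aeval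
    (((Commute.one_left _).add_left ((jm_comm hn hi).smul_left _)).smul_left _) f) h0
  have h2 : jmMul q n m * w = algebraMap F (Hecke F q n) ((q ^ m)⁻¹ * (1 + (q - 1) * z)) * w := by
    rw [← Algebra.smul_def, jmMul, smul_mul_assoc, add_mul, smul_mul_assoc, hz, one_mul]
    module
  rw [aeval_mul_eq_of_mul_eq (Algebra.commutes _ _) h2, aeval_algebraMap_apply,
    ← Algebra.smul_def, smul_eq_zero_iff_left hw] at h1
  obtain ⟨d, hd, h3⟩ := hf.2 _ (by simpa using h1)
  obtain ⟨d', hd'⟩ : ∃ d' : ℕ, (d' : ℤ) = m + d := ⟨(m + d).toNat, by omega⟩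
  refine ⟨d', by omega, ?_⟩
  have h4 : 1 + (q - 1) * z = q ^ d' := by
    rw [← zpow_natCast, hd', zpow_add₀ hq, ← h3, zpow_natCast,
      mul_inv_cancel_left₀ (pow_ne_zero _ hq)]
  have h5 : z = qInt q d' := by
    apply mul_left_cancel₀ (sub_ne_zero.mpr hq1)
    rw [qInt, mul_comm _ (∑ _ ∈ _, _), geom_sum_mul, ← h4, add_sub_cancel_left]
  rw [hz, h5]

/-- If `Z_{j+i}` acts on `w` as `[d]_q` with `d ≥ i`, the operators of `jmShuffle` act by scalars
that are the product of a `q`-factorial and a polynomial with nonnegative coefficients. -/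
theorem exists_jmShuffle_mul_eq (hq : q ≠ 0) {j : ℕ} {w : Hecke F q n}
    (hw : ∀ m, j < m → m ≤ n → ∃ d : ℕ, m ≤ d + j ∧ jm F q n m * w = qInt q d • w)
    (i k : ℕ) (hi : j + i ≤ n) :
    ∃ g : ℕ[X], (i < k → g = 0) ∧
      jmShuffle F q n j i k * w = (qFactorial q k * aeval q g) • w := by
  induction i generalizing k with
  | zero =>
    cases k with
    | zero => exact ⟨1, by simp, by simp [jmShuffle, qFactorial]⟩
    | succ k => exact ⟨0, by simp, by simp [jmShuffle]⟩
  | succ i ih =>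
    cases k with
    | zero => exact ⟨1, by simp, by simp [jmShuffle, qFactorial]⟩
    | succ k =>
      obtain ⟨g, hg, h1⟩ := ih (k + 1) (by omega)
      obtain ⟨g', hg', h2⟩ := ih k (by omega)
      obtain ⟨d, hd, h3⟩ := hw (j + i + 1) (by omega) hi
      refine ⟨X ^ (k + 1) * g + (∑ s ∈ Finset.range (d - k), X ^ s) * g', fun h => by
        rw [hg (by omega), hg' (by omega), mul_zero, mul_zero, add_zero], ?_⟩
      have h4 : (aeval q g' : F) * (qInt q d - qInt q k) =
          q ^ k * (aeval q g' * aeval q (∑ s ∈ Finset.range (d - k), X ^ s : ℕ[X])) := by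
        obtain h | h := Nat.lt_or_ge i k
        · simp [hg' h]
        · obtain ⟨e, rfl⟩ : ∃ e, d = k + e := ⟨d - k, by omega⟩
          rw [qInt_add, add_sub_cancel_left, add_tsub_cancel_left, map_sum]
          simp only [map_pow, aeval_X, qInt]
          ring
      rw [jmShuffle, add_mul, smul_mul_assoc, h1, smul_mul_assoc, mul_assoc, h2, mul_smul_comm,
        sub_mul, h3, smul_mul_assoc, one_mul, ← sub_smul, smul_smul, smul_smul, smul_smul,
        ← add_smul, qFactorial_succ]
      congr 1
      rw [mul_assoc _ _ (qInt q d - qInt q k), mul_assoc (qFactorial q k) _ (_ - _), h4, map_add,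
        map_mul, map_mul, map_pow, aeval_X]
      field_simp

/-- All eigenvalues of the random-to-random shuffle are values of polynomials with nonnegative
coefficients. -/
theorem exists_eigenvalue_eq_aeval [IsAlgClosed F] [FiniteDimensional F (Hecke F q n)]
    (hq : q ≠ 0) (hq1 : q ≠ 1) {k : ℕ} (hk : qFactorial q k ≠ 0) {r v : Hecke F q n} {e : F}
    (hr : qFactorial q k • r = kRandomToBottom F q n k * kBottomToRandom F q n k)
    (hv : v ≠ 0) (h : r * v = e • v) : ∃ p : ℕ[X], e = aeval q p := by
  obtain ⟨j, i, hn, hu, hB⟩ := exists_ascB_mul_ne_zero hv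
  have h1 := ascB_mul_shuffleProd (k := k) hq hn.le hB
  rw [hn, shuffleProd_self, ← hr, smul_mul_assoc, h, mul_smul_comm, mul_smul_comm, smul_smul] at h1
  have hT (s : ℕ) (hs : j < s) (hs' : s < n) :
      T F q n s * (ascB F q n j i * v) = q • (ascB F q n j i * v) := by
    rw [← mul_assoc, T_mul_ascB hs (by omega) hn.le, smul_mul_assoc]
  obtain ⟨w, hw, huw, hz⟩ := exists_common_eigenvector hu le_rfl
  obtain ⟨g, -, hg⟩ := exists_jmShuffle_mul_eq hq (w := w) (fun m hm hmn =>
    (hz m hmn).elim fun z hz => exists_jm_mul_eq hq hq1 hm hmn hT hw huw hz) i k hn.le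
  have h2 := huw (jmShuffle F q n j i k - (qFactorial q k * e) • 1)
    (fun l hl => (jmShuffle_comm_jm hn.le hl).sub_left ((Commute.one_left _).smul_left _))
    (by rw [sub_mul, ← h1, smul_mul_assoc, one_mul, sub_self])
  rw [sub_mul, hg, smul_mul_assoc, one_mul, ← sub_smul, smul_eq_zero_iff_left hw, ← mul_sub,
    mul_eq_zero_iff_left hk, sub_eq_zero] at h2
  exact ⟨g, h2.symm⟩

end Spectrum

/-! ### Freeness of the Hecke algebra -/

section Freeness

variable {R : Type*} [CommRing R] {q : R} {n : ℕ}

theorem hecke_induction {P : Hecke R q n → Prop} (halg : ∀ r, P (algebraMap R _ r))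
    (hgen : ∀ i, P (gen R q n i)) (hmul : ∀ a b, P a → P b → P (a * b))
    (hadd : ∀ a b, P a → P b → P (a + b)) (a : Hecke R q n) : P a := by
  obtain ⟨a, rfl⟩ := RingQuot.mkAlgHom_surjective R (Rel R q n) a
  induction a using FreeAlgebra.induction with
  | grade0 r => rw [AlgHom.commutes]; exact halg r
  | grade1 i => exact hgen i
  | mul a b ha hb => rw [map_mul]; exact hmul _ _ ha hb
  | add a b ha hb => rw [map_add]; exact hadd _ _ ha hb

open Classical in
variable (R q n) in
/-- The products of descending products `T_l ⋯ T_i` (possibly empty), one for each `l < m`, in the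
order of increasing `l`; they are the basis elements `T_w` with `w` in `𝔖_m`. -/
def normalForms : ℕ → Finset (Hecke R q n)
  | 0 => {1}
  | m + 1 => (normalForms m ×ˢ Finset.range (m + 1)).image
      fun x => x.1 * desc R q n (m + 1 - x.2) x.2

theorem one_mem_normalForms (m : ℕ) : 1 ∈ normalForms R q n m := by
  induction m with
  | zero => simp [normalForms]
  | succ m ih => classical exact Finset.mem_image.mpr ⟨(1, 0), by simp [ih], by simp [desc]⟩

theorem card_normalForms_le (m : ℕ) : (normalForms R q n m).card ≤ m.factorial := by
  induction m with
  | zero => simp [normalForms]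
  | succ m ih =>
    classical
    refine Finset.card_image_le.trans ?_
    rw [Finset.card_product, Finset.card_range, Nat.factorial_succ, mul_comm]
    exact Nat.mul_le_mul_left _ ih

theorem mul_desc_mem_span {m l : ℕ} (hl : l ≤ m) {a : Hecke R q n}
    (ha : a ∈ Submodule.span R (normalForms R q n m : Set (Hecke R q n))) :
    a * desc R q n (m + 1 - l) l ∈
      Submodule.span R (normalForms R q n (m + 1) : Set (Hecke R q n)) := by
  induction ha using Submodule.span_induction with
  | mem s hs =>
    classical
    refine Submodule.subset_span (Finset.mem_image.mpr ⟨(s, l), ?_, rfl⟩)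
    simp only [Finset.mem_product, Finset.mem_range]
    exact ⟨hs, by omega⟩
  | zero => rw [zero_mul]; exact zero_mem _
  | add a b _ _ ha hb => rw [add_mul]; exact add_mem ha hb
  | smul c a _ ha => rw [smul_mul_assoc]; exact Submodule.smul_mem _ c ha

theorem mul_T_mem_span {m j : ℕ} (hm : m ≤ n) (h1 : 1 ≤ j) (hj : j < m) {a : Hecke R q n}
    (ha : a ∈ Submodule.span R (normalForms R q n m : Set (Hecke R q n))) :
    a * T R q n j ∈ Submodule.span R (normalForms R q n m : Set (Hecke R q n)) := by
  induction m generalizing j a with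
  | zero => omega
  | succ m ih =>
    induction ha using Submodule.span_induction with
    | zero => rw [zero_mul]; exact zero_mem _
    | add a b _ _ ha hb => rw [add_mul]; exact add_mem ha hb
    | smul c a _ ha => rw [smul_mul_assoc]; exact Submodule.smul_mem _ c ha
    | mem s hs =>
      classical
      obtain ⟨⟨s, l⟩, h, rfl⟩ := Finset.mem_image.mp hs
      simp only [Finset.mem_product, Finset.mem_range] at h
      obtain ⟨h', hl⟩ := h
      have hs' := Submodule.subset_span (R := R) (Finset.mem_coe.mpr h')
      obtain ⟨p, hp⟩ : ∃ p, p = m + 1 - l := ⟨_, rfl⟩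
      simp only [← hp]
      rw [mul_assoc]
      obtain h | h | h | h : j + 1 < p ∨ j + 1 = p ∨ j = p ∨ p < j := by omega
      · rw [← (T_comm_desc h l).eq, ← mul_assoc, hp]
        exact mul_desc_mem_span (by omega) (ih (by omega) h1 (by omega) hs')
      · rw [← h, desc_mul_T, show j = m + 1 - (l + 1) by omega]
        exact mul_desc_mem_span (by omega) hs'
      · obtain ⟨l, rfl⟩ : ∃ l', l = l' + 1 := ⟨l - 1, by omega⟩
        rw [h, ← desc_mul_T, mul_assoc, T_mul_self (by omega) (by omega), mul_add, mul_smul_comm,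
          mul_smul_comm, mul_one, desc_mul_T, mul_add, mul_smul_comm, mul_smul_comm]
        refine add_mem (Submodule.smul_mem _ _ ?_) (Submodule.smul_mem _ _ ?_)
        · rw [hp]; exact mul_desc_mem_span (by omega) hs'
        · rw [show p + 1 = m + 1 - l by omega]; exact mul_desc_mem_span (by omega) hs'
      · obtain ⟨j, rfl⟩ : ∃ j', j = j' + 1 := ⟨j - 1, by omega⟩
        rw [← T_mul_desc (by omega) (by omega), ← mul_assoc, hp]
        exact mul_desc_mem_span (by omega) (ih (by omega) (by omega) (by omega) hs')

/-- The span of the normal forms contains `1` and is stable under right multiplication by the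
generators. -/
theorem span_normalForms :
    Submodule.span R (normalForms R q n n : Set (Hecke R q n)) = ⊤ := by
  rw [eq_top_iff]
  rintro a -
  suffices h : ∀ v ∈ Submodule.span R (normalForms R q n n : Set (Hecke R q n)),
      v * a ∈ Submodule.span R (normalForms R q n n : Set (Hecke R q n)) by
    simpa using h 1 (Submodule.subset_span (one_mem_normalForms n))
  induction a using hecke_induction with
  | halg r =>
    intro v hv
    rw [← Algebra.commutes, ← Algebra.smul_def]; exact Submodule.smul_mem _ r hv
  | hgen i =>
    intro v hv
    rw [← T_of_lt i.2]; exact mul_T_mem_span le_rfl (by omega) (by omega) hv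
  | hmul a b ha hb => intro v hv; rw [← mul_assoc]; exact hb _ (ha _ hv)
  | hadd a b ha hb => intro v hv; rw [mul_add]; exact add_mem (ha _ hv) (hb _ hv)

instance : Module.Finite R (Hecke R q n) := ⟨⟨_, span_normalForms⟩⟩

/-- Right multiplication by `T_s` in terms of the basis elements `T_w`, where `s` is the `i`-th
simple transposition; the length of `w` grows exactly when `w i < w (i + 1)`. -/
def permAct (R : Type*) [CommRing R] (q : R) (n : ℕ) (i : Fin (n - 1)) :
    Module.End R (Equiv.Perm (Fin n) →₀ R) :=
  Finsupp.lsum R fun w => LinearMap.toSpanSingleton R _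
    (if w ⟨i, by omega⟩ < w ⟨i + 1, by omega⟩ then
      Finsupp.single (w * simpleTransposition i) (1 : R)
    else (q - 1) • Finsupp.single w (1 : R) +
      q • Finsupp.single (w * simpleTransposition i) (1 : R))

theorem permAct_single (i : Fin (n - 1)) (w : Equiv.Perm (Fin n)) :
    permAct R q n i (Finsupp.single w 1) =
      if w ⟨i, by omega⟩ < w ⟨i + 1, by omega⟩ then
        Finsupp.single (w * simpleTransposition i) (1 : R)
      else (q - 1) • Finsupp.single w (1 : R) +
        q • Finsupp.single (w * simpleTransposition i) (1 : R) := by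
  simp [permAct]

theorem simpleTransposition_apply_self (i : Fin (n - 1)) :
    simpleTransposition i ⟨i, by omega⟩ = ⟨i + 1, by omega⟩ := by
  simp [simpleTransposition]

theorem simpleTransposition_apply_succ (i : Fin (n - 1)) :
    simpleTransposition i ⟨i + 1, by omega⟩ = ⟨i, by omega⟩ := by
  simp [simpleTransposition]

theorem simpleTransposition_apply_of_ne (i : Fin (n - 1)) {x : ℕ} (hx : x < n) (h1 : x ≠ i)
    (h2 : x ≠ i + 1) : simpleTransposition i ⟨x, hx⟩ = ⟨x, hx⟩ :=
  Equiv.swap_apply_of_ne_of_ne (by simpa using h1) (by simpa using h2)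

theorem simpleTransposition_mul_self (i : Fin (n - 1)) :
    simpleTransposition i * simpleTransposition i = 1 := Equiv.swap_mul_self _ _

theorem simpleTransposition_braid (i j : Fin (n - 1)) (h : (j : ℕ) = i + 1) :
    simpleTransposition i * simpleTransposition j * simpleTransposition i =
      simpleTransposition j * simpleTransposition i * simpleTransposition j := by
  have hb : (⟨j, by omega⟩ : Fin n) = ⟨i + 1, by omega⟩ := by simp [h]
  have hc : (⟨j + 1, by omega⟩ : Fin n) = ⟨i + 1 + 1, by omega⟩ := by simp [h]
  have h1 : (⟨i, by omega⟩ : Fin n) ≠ ⟨i + 1 + 1, by omega⟩ := by simp; omega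
  have h2 : (⟨i + 1, by omega⟩ : Fin n) ≠ ⟨i + 1 + 1, by omega⟩ := by simp
  have h3 : (⟨i, by omega⟩ : Fin n) ≠ ⟨i + 1, by omega⟩ := by simp
  rw [simpleTransposition, simpleTransposition, hb, hc, Equiv.swap_mul_swap_mul_swap h3 h1,
    Equiv.swap_comm (⟨i + 1, _⟩ : Fin n) ⟨i + 1 + 1, _⟩, Equiv.swap_comm (⟨i, _⟩ : Fin n),
    Equiv.swap_mul_swap_mul_swap h2.symm h1.symm, Equiv.swap_comm]

theorem permAct_mul_self (i : Fin (n - 1)) :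
    permAct R q n i * permAct R q n i = (q - 1) • permAct R q n i + q • 1 := by
  refine Finsupp.lhom_ext' fun w => LinearMap.ext_ring ?_
  have hne : w ⟨i, by omega⟩ ≠ w ⟨i + 1, by omega⟩ := fun h => by simpa using w.injective h
  simp only [LinearMap.comp_apply, Finsupp.lsingle_apply, Module.End.mul_apply, permAct_single,
    LinearMap.add_apply, LinearMap.smul_apply, Module.End.one_apply]
  obtain h | h := hne.lt_or_gt
  · rw [if_pos h, permAct_single, if_neg]
    · simp [mul_assoc, simpleTransposition_mul_self]
    · simp [simpleTransposition_apply_self, simpleTransposition_apply_succ, h.le]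
  · rw [if_neg h.not_gt, map_add, map_smul, map_smul, permAct_single, permAct_single,
      if_neg h.not_gt, if_pos]
    · simp [mul_assoc, simpleTransposition_mul_self]
    · simpa [simpleTransposition_apply_self, simpleTransposition_apply_succ]

theorem permAct_comm (i j : Fin (n - 1)) (h : (i : ℕ) + 1 < j ∨ (j : ℕ) + 1 < i) :
    permAct R q n i * permAct R q n j = permAct R q n j * permAct R q n i := by
  refine Finsupp.lhom_ext' fun w => LinearMap.ext_ring ?_
  have hs : w * simpleTransposition i * simpleTransposition j =
      w * simpleTransposition j * simpleTransposition i := by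
    rw [mul_assoc, mul_assoc]
    congr 1
    refine Equiv.Perm.Disjoint.commute fun x => ?_
    simp only [simpleTransposition, or_iff_not_imp_left]
    intro hx
    refine Equiv.swap_apply_of_ne_of_ne ?_ ?_ <;>
    (rintro rfl; exact hx (Equiv.swap_apply_of_ne_of_ne (by simp; omega) (by simp; omega)))
  have h1 := simpleTransposition_apply_of_ne i (x := j) (by omega) (by omega) (by omega)
  have h2 := simpleTransposition_apply_of_ne i (x := j + 1) (by omega) (by omega) (by omega)
  have h3 := simpleTransposition_apply_of_ne j (x := i) (by omega) (by omega) (by omega)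
  have h4 := simpleTransposition_apply_of_ne j (x := i + 1) (by omega) (by omega) (by omega)
  simp only [LinearMap.comp_apply, Finsupp.lsingle_apply, Module.End.mul_apply, permAct_single]
  by_cases hi : w ⟨i, by omega⟩ < w ⟨i + 1, by omega⟩ <;>
  by_cases hj : w ⟨j, by omega⟩ < w ⟨j + 1, by omega⟩ <;>
  · simp only [hi, hj, if_true, if_false, map_add, map_smul, permAct_single, Equiv.Perm.mul_apply,
      h1, h2, h3, h4, hs]
    try module

theorem permAct_braid (i j : Fin (n - 1)) (h : (j : ℕ) = i + 1) :
    permAct R q n i * permAct R q n j * permAct R q n i =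
      permAct R q n j * permAct R q n i * permAct R q n j := by
  refine Finsupp.lhom_ext' fun w => LinearMap.ext_ring ?_
  have hs := simpleTransposition_braid i j h
  have e : (⟨j, by omega⟩ : Fin n) = ⟨i + 1, by omega⟩ := by simp [h]
  have e' : (⟨j + 1, by omega⟩ : Fin n) = ⟨i + 1 + 1, by omega⟩ := by simp [h]
  have h1 := simpleTransposition_apply_self i
  have h2 := simpleTransposition_apply_succ i
  have h3 := simpleTransposition_apply_of_ne i (x := i + 1 + 1) (by omega) (by omega) (by omega)
  have h4 := simpleTransposition_apply_of_ne j (x := i) (by omega) (by omega) (by omega)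
  have h5 := simpleTransposition_apply_self j
  have h6 := simpleTransposition_apply_succ j
  rw [e, e'] at h5 h6
  have hab : w ⟨i, by omega⟩ ≠ w ⟨i + 1, by omega⟩ := fun h => by simpa using w.injective h
  have hbc : w ⟨i + 1, by omega⟩ ≠ w ⟨i + 1 + 1, by omega⟩ := fun h => by simpa using w.injective h
  have hac : w ⟨i, by omega⟩ ≠ w ⟨i + 1 + 1, by omega⟩ := fun h => by
    have := w.injective h
    simp at this
    omega
  simp only [LinearMap.comp_apply, Finsupp.lsingle_apply, Module.End.mul_apply, permAct_single, e,
    e']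
  rcases hab.lt_or_gt with hab | hab <;> rcases hbc.lt_or_gt with hbc | hbc <;>
  rcases hac.lt_or_gt with hac | hac <;>
  first
  | (exfalso; order)
  | (simp only [hab, hbc, hac, hab.not_gt, hbc.not_gt, hac.not_gt, if_true, if_false, map_add,
      map_smul, permAct_single, Equiv.Perm.mul_apply, e, e', h1, h2, h3, h4, h5, h6,
      mul_assoc w, hs, simpleTransposition_mul_self, mul_one]
     try module)

variable (R q n) in
/-- The representation of the Hecke algebra on the free module with basis `𝔖_n` in which `T_i` acts
as right multiplication by `T_i`. It is a left representation since the defining relations are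
invariant under the reversal of products. -/
def permRep : Hecke R q n →ₐ[R] Module.End R (Equiv.Perm (Fin n) →₀ R) :=
  lift (permAct R q n) permAct_mul_self permAct_comm permAct_braid

variable (R q n) in
/-- The orbit map of the identity permutation; it sends `T_w` to `w⁻¹`. -/
def permOrbit : Hecke R q n →ₗ[R] (Equiv.Perm (Fin n) →₀ R) :=
  LinearMap.applyₗ (Finsupp.single 1 1) ∘ₗ (permRep R q n).toLinearMap

theorem permOrbit_gen_mul (i : Fin (n - 1)) (a : Hecke R q n) :
    permOrbit R q n (gen R q n i * a) = permAct R q n i (permOrbit R q n a) := by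
  simp [permOrbit, permRep]

/-- The image of the orbit map contains a multiple of each basis vector, the factor being
`q ^ N` for a word with `N` descents. -/
theorem exists_permOrbit_eq (w : Equiv.Perm (Fin n)) :
    ∃ N a, permOrbit R q n a = q ^ N • Finsupp.single w 1 := by
  obtain ⟨l, rfl⟩ := exists_word w
  induction l using List.reverseRecOn with
  | nil => exact ⟨0, 1, by simp [permOrbit]⟩
  | append_singleton l i ih =>
    obtain ⟨N, a, h⟩ := ih
    rw [List.map_append, List.prod_append, List.map_singleton, List.prod_singleton]
    generalize (l.map simpleTransposition).prod = w at *
    have h1 := permOrbit_gen_mul i a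
    rw [h, map_smul, permAct_single] at h1
    split_ifs at h1
    · exact ⟨N, _, h1⟩
    · refine ⟨N + 1, gen R q n i * a - (q - 1) • a, ?_⟩
      rw [map_sub, h1, map_smul, h, smul_comm (q - 1), ← smul_sub, add_sub_cancel_left, smul_smul,
        pow_succ]

/-- A matrix with a right inverse up to a nonsingular diagonal matrix is nonsingular. -/
theorem injective_of_forall_exists_smul_eq [IsDomain R] {ι : Type*} [Finite ι]
    (f : (ι →₀ R) →ₗ[R] (ι →₀ R))
    (h : ∀ i, ∃ c : R, c ≠ 0 ∧ ∃ v, f v = c • Finsupp.single i 1) : Function.Injective f := by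
  classical
  have := Fintype.ofFinite ι
  choose c hc v hv using h
  let b : Module.Basis ι R (ι →₀ R) := Finsupp.basisSingleOne
  have h1 : LinearMap.toMatrix b b f * LinearMap.toMatrix b b (b.constr R v) =
      Matrix.diagonal c := by
    rw [← LinearMap.toMatrix_comp]
    ext i j
    rw [LinearMap.toMatrix_apply, LinearMap.comp_apply, b.constr_basis, hv]
    simp [b, Matrix.diagonal_apply, Finsupp.single_apply, eq_comm]
    grind
  have h2 : (LinearMap.toMatrix b b f).det ≠ 0 := by
    intro h2
    have h3 := congrArg Matrix.det h1
    rw [Matrix.det_mul, h2, zero_mul, Matrix.det_diagonal] at h3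
    exact Finset.prod_ne_zero_iff.mpr (fun i _ => hc i) h3.symm
  refine (injective_iff_map_eq_zero f).mpr fun x hx => ?_
  have h3 := Matrix.eq_zero_of_mulVec_eq_zero h2 (v := b.repr x)
    (by rw [LinearMap.toMatrix_mulVec_repr, hx]; simp)
  exact b.repr.injective (by ext i; simpa using congrFun h3 i)

/-- The Hecke algebra is a free module of rank `n!`: it is spanned by `n!` products, and these are
independent since the orbit map sends their span onto a submodule of full rank `n!`. -/
theorem nonempty_basis [IsDomain R] (hq : q ≠ 0) :
    Nonempty (Module.Basis (Equiv.Perm (Fin n)) R (Hecke R q n)) := by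
  classical
  have hcard : Fintype.card (normalForms R q n n) ≤ Fintype.card (Equiv.Perm (Fin n)) := by
    rw [Fintype.card_coe, Fintype.card_perm, Fintype.card_fin]
    exact card_normalForms_le n
  obtain ⟨g⟩ := Function.Embedding.nonempty_of_card_le hcard
  have : Nonempty (normalForms R q n n) := ⟨⟨1, one_mem_normalForms n⟩⟩
  let b : Equiv.Perm (Fin n) → Hecke R q n := fun w => (Function.invFun g w).1
  have hb : Set.range b = normalForms R q n n := by
    ext x
    constructor
    · rintro ⟨w, rfl⟩; exact (Function.invFun g w).2
    · intro hx; exact ⟨g ⟨x, hx⟩, by simp [b, Function.leftInverse_invFun g.injective _]⟩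
  have hspan : Submodule.span R (Set.range b) = ⊤ := by rw [hb]; exact span_normalForms
  have hinj := injective_of_forall_exists_smul_eq
    (permOrbit R q n ∘ₗ Finsupp.linearCombination R b) fun w => by
      obtain ⟨N, a, h⟩ := exists_permOrbit_eq (q := q) w
      obtain ⟨v, rfl⟩ : a ∈ LinearMap.range (Finsupp.linearCombination R b) := by
        rw [Finsupp.range_linearCombination, hspan]; trivial
      exact ⟨q ^ N, pow_ne_zero _ hq, v, h⟩
  rw [LinearMap.coe_comp] at hinj
  exact ⟨Module.Basis.mk (v := b) hinj.of_comp hspan.ge⟩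

theorem hecke_free [IsDomain R] (hq : q ≠ 0) : Module.Free R (Hecke R q n) :=
  Module.Free.of_basis (nonempty_basis hq).some

end Freeness

/-! ### Specialization of eigenvalues -/

section Specialization

variable {A : Type*} [CommRing A] {M : Type*} [AddCommGroup M] [Module A M]

/-- A finite faithful module has nonzero fibres everywhere (Nakayama). -/
theorem nontrivial_baseChange_of_annihilator [IsDomain A] [Module.Finite A M]
    (h : Module.annihilator A M = ⊥) (K : Type*) [Field K] [Algebra A K] :
    Nontrivial (K ⊗[A] M) := by
  have hp : (RingHom.ker (algebraMap A K)).IsPrime := RingHom.ker_isPrime _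
  -- The fibre over `K` is a scalar extension of the fibre at the prime `ker (A → K)`.
  let p : PrimeSpectrum A := ⟨RingHom.ker (algebraMap A K), hp⟩
  have h1 : Nontrivial (p.asIdeal.ResidueField ⊗[A] M) := by
    rw [← Module.mem_support_iff_nontrivial_residueField_tensorProduct,
      Module.mem_support_iff_of_finite, h]
    exact bot_le
  let φ : p.asIdeal.ResidueField →ₐ[A] K := Ideal.ResidueField.liftₐ p.asIdeal (Algebra.ofId A K)
    le_rfl fun x hx => by
      have : algebraMap A K x ≠ 0 := hx
      exact this.isUnit
  let _ : Algebra p.asIdeal.ResidueField K := φ.toRingHom.toAlgebra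
  have : IsScalarTower A p.asIdeal.ResidueField K := IsScalarTower.of_algHom φ
  have h2 : Nontrivial (K ⊗[p.asIdeal.ResidueField] (p.asIdeal.ResidueField ⊗[A] M)) :=
    inferInstance
  exact (AlgebraTensorModule.cancelBaseChange A
    p.asIdeal.ResidueField K K M).symm.toEquiv.nontrivial

/-- A module that is nonzero generically is faithful. -/
theorem annihilator_eq_bot_of_nontrivial {F : Type*} [Field F] [Algebra A F]
    (hF : Function.Injective (algebraMap A F)) [Nontrivial (F ⊗[A] M)] :
    Module.annihilator A M = ⊥ := by
  refine eq_bot_iff.mpr fun a ha => ?_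
  rw [Module.mem_annihilator] at ha
  by_contra h0
  have h1 : algebraMap A F a ≠ 0 := fun h => h0 (hF (by rw [h, map_zero]))
  obtain ⟨x, hx⟩ := exists_ne (0 : F ⊗[A] M)
  apply hx
  have h2 (y : F ⊗[A] M) : a • y = 0 := by
    induction y with
    | zero => simp
    | tmul b m => rw [← TensorProduct.tmul_smul, ha, TensorProduct.tmul_zero]
    | add y z hy hz => rw [smul_add, hy, hz, add_zero]
  exact (smul_eq_zero_iff_right h1).mp ((algebraMap_smul F a x).trans (h2 x))

/-- An endomorphism of a finite module that is not surjective generically is not surjective in any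
fibre. -/
theorem not_surjective_baseChange [IsDomain A] [Module.Finite A M] {F : Type*} [Field F]
    [Algebra A F] (hF : Function.Injective (algebraMap A F)) (g : Module.End A M)
    (hg : ¬ Function.Surjective (g.baseChange F)) (K : Type*) [Field K] [Algebra A K] :
    ¬ Function.Surjective (g.baseChange K) := by
  intro h
  have hF' : Nontrivial (F ⊗[A] (M ⧸ LinearMap.range g)) := by
    by_contra h1
    rw [not_nontrivial_iff_subsingleton] at h1
    refine hg fun x => ?_
    exact (lTensor_exact F (LinearMap.exact_map_mkQ_range g) (Submodule.mkQ_surjective _) x).mp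
      (Subsingleton.elim _ _)
  have hK := nontrivial_baseChange_of_annihilator (annihilator_eq_bot_of_nontrivial
    (M := M ⧸ LinearMap.range g) hF) K
  obtain ⟨x, hx⟩ := exists_ne (0 : K ⊗[A] (M ⧸ LinearMap.range g))
  obtain ⟨y, rfl⟩ := LinearMap.lTensor_surjective K (Submodule.mkQ_surjective (LinearMap.range g)) x
  exact hx ((lTensor_exact K (LinearMap.exact_map_mkQ_range g) (Submodule.mkQ_surjective _) y).mpr
    (h y))

/-- Over a field, `s` is an eigenvalue of an endomorphism `f` of a finite module exactly if `f - s`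
is not surjective. -/
theorem hasEigenvalue_baseChange_iff [Module.Finite A M] {K : Type*} [Field K] [Algebra A K]
    (f : Module.End A M) (s : A) :
    Module.End.HasEigenvalue (f.baseChange K : Module.End K (K ⊗[A] M)) (algebraMap A K s) ↔
      ¬ Function.Surjective ((f - s • 1 : Module.End A M).baseChange K) := by
  have h : ((f - s • 1 : Module.End A M).baseChange K : Module.End K (K ⊗[A] M)) =
      f.baseChange K - algebraMap A K s • 1 := by
    ext m
    simp
  rw [h, Module.End.hasEigenvalue_iff, Module.End.eigenspace_def,
    ← LinearMap.injective_iff_surjective, ← LinearMap.ker_eq_bot]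

/-- If all generic eigenvalues of an endomorphism `f` of a finite torsion-free module over a domain
`A` lie in `A`, the eigenvalues of every specialization of `f` are their specializations. -/
theorem exists_finset_hasEigenvalue_iff [IsDomain A] [Module.Finite A M] {F : Type*} [Field F]
    [IsAlgClosed F] [Algebra A F] (hF : Function.Injective (algebraMap A F))
    (hM : Function.Injective fun m : M => (1 : F) ⊗ₜ[A] m) (f : Module.End A M) (S : Set A)
    (hS : ∀ e, Module.End.HasEigenvalue (f.baseChange F : Module.End F (F ⊗[A] M)) e →
      ∃ s ∈ S, e = algebraMap A F s) :
    ∃ P : Finset A, (∀ s ∈ P, s ∈ S) ∧ ∀ (K : Type*) [Field K] [Algebra A K] (x : K),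
      Module.End.HasEigenvalue (f.baseChange K : Module.End K (K ⊗[A] M)) x ↔
        ∃ s ∈ P, x = algebraMap A K s := by
  classical
  set fF : Module.End F (F ⊗[A] M) := f.baseChange F with hfF
  have hroot {e : F} (he : e ∈ fF.charpoly.roots) : Module.End.HasEigenvalue fF e :=
    (Module.End.hasEigenvalue_iff_isRoot_charpoly fF e).mpr (isRoot_of_mem_roots he)
  choose! s hs hs' using hS
  refine ⟨(fF.charpoly.roots.map s).toFinset, fun a ha => ?_, fun K _ _ x => ⟨fun hx => ?_, ?_⟩⟩
  · obtain ⟨e, he, rfl⟩ := Multiset.mem_map.mp (Multiset.mem_toFinset.mp ha)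
    exact hs e (hroot he)
  · -- The generic characteristic polynomial, with its coefficients in `A`, annihilates `f`.
    let p : A[X] := (fF.charpoly.roots.map fun e => X - C (s e)).prod
    have hp : p.map (algebraMap A F) = fF.charpoly := by
      rw [(IsAlgClosed.splits fF.charpoly).eq_prod_roots_of_monic fF.charpoly_monic,
        Polynomial.map_multiset_prod, Multiset.map_map]
      congr 1
      refine Multiset.map_congr rfl fun e he => ?_
      simp [← hs' e (hroot he)]
    have h0 : aeval f p = 0 := by
      ext m
      apply hM
      have h1 : aeval fF p = 0 := by
        rw [← aeval_map_algebraMap F, hp, LinearMap.aeval_self_charpoly]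
      have h2 : aeval fF p = (aeval f p).baseChange F :=
        aeval_algHom_apply (Module.End.baseChangeHom A F M) f p
      have h3 := congr($(h2.symm.trans h1) (1 ⊗ₜ m))
      simpa using h3
    have h1 : aeval (f.baseChange K : Module.End K (K ⊗[A] M)) (p.map (algebraMap A K)) = 0 := by
      rw [aeval_map_algebraMap, show (f.baseChange K : Module.End K (K ⊗[A] M)) =
        Module.End.baseChangeHom A K M f from rfl, aeval_algHom_apply, h0, map_zero]
    obtain ⟨v, hv⟩ := hx.exists_hasEigenvector
    have h2 := Module.End.aeval_apply_of_hasEigenvector (p := p.map (algebraMap A K)) hv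
    rw [h1, LinearMap.zero_apply, eq_comm, smul_eq_zero_iff_left hv.2, eval_map,
      ← coe_eval₂RingHom, map_multiset_prod, Multiset.prod_eq_zero_iff] at h2
    obtain ⟨g, hg, h2⟩ := Multiset.mem_map.mp h2
    obtain ⟨e, he, rfl⟩ := Multiset.mem_map.mp hg
    refine ⟨s e, Multiset.mem_toFinset.mpr (Multiset.mem_map_of_mem s he), ?_⟩
    simpa [sub_eq_zero] using h2
  · -- `f - s` is not surjective generically, hence nowhere.
    rintro ⟨a, ha, rfl⟩
    obtain ⟨e, he, rfl⟩ := Multiset.mem_map.mp (Multiset.mem_toFinset.mp ha)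
    have h1 := hroot he
    rw [hs' e h1, hfF, hasEigenvalue_baseChange_iff] at h1
    rw [hasEigenvalue_baseChange_iff]
    exact not_surjective_baseChange hF _ h1 K

end Specialization

/-! ### Base change of the Hecke algebra and of the shuffling elements -/

section BaseChange

variable {K : Type*} [Field K] (q : K) (n : ℕ)

theorem specialize_T (i : ℕ) : specialize q n (T ℤ[X] X n i) = T K q n i := by
  unfold T
  split_ifs
  · exact specialize_gen q n _
  · exact map_zero _

theorem specialize_B (m : ℕ) : specialize q n (B ℤ[X] X n m) = B K q n m := by
  simp [B, map_sum, map_list_prod, Function.comp_def, specialize_T]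

theorem specialize_Bstar (m : ℕ) : specialize q n (Bstar ℤ[X] X n m) = Bstar K q n m := by
  simp [Bstar, map_sum, map_list_prod, Function.comp_def, specialize_T]

theorem specialize_kBottomToRandom (k : ℕ) :
    specialize q n (kBottomToRandom ℤ[X] X n k) = kBottomToRandom K q n k := by
  simp [kBottomToRandom, map_list_prod, Function.comp_def, specialize_B]

theorem specialize_kRandomToBottom (k : ℕ) :
    specialize q n (kRandomToBottom ℤ[X] X n k) = kRandomToBottom K q n k := by
  simp [kRandomToBottom, map_list_prod, Function.comp_def, specialize_Bstar]

theorem evalHom_qFactorial (k : ℕ) : evalHom q (qFactorial X k) = qFactorial q k := by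
  simp [qFactorial, qInt]

theorem qFactorial_smul_genericRandomToRandom (k : ℕ) :
    qFactorial (X : ℤ[X]) k • genericRandomToRandom n k =
      kRandomToBottom ℤ[X] X n k * kBottomToRandom ℤ[X] X n k :=
  Classical.epsilon_spec (exists_qFactorial_smul_eq k)

theorem qFactorial_smul_randomToRandom (k : ℕ) :
    qFactorial q k • randomToRandom q n k = kRandomToBottom K q n k * kBottomToRandom K q n k := by
  rw [randomToRandom, ← evalHom_qFactorial, ← specialize_smul,
    qFactorial_smul_genericRandomToRandom, map_mul, specialize_kBottomToRandom,
    specialize_kRandomToBottom]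

theorem hecke_algHom_ext {R : Type*} [CommRing R] {q : R} {A : Type*} [Semiring A] [Algebra R A]
    {f g : Hecke R q n →ₐ[R] A} (h : ∀ i, f (gen R q n i) = g (gen R q n i)) : f = g := by
  ext a
  induction a using hecke_induction with
  | halg r => simp
  | hgen i => exact h i
  | hmul a b ha hb => simp [ha, hb]
  | hadd a b ha hb => simp [ha, hb]

/-- The Hecke algebra commutes with base change. -/
theorem exists_baseChange_equiv [Algebra ℤ[X] K] (h : algebraMap ℤ[X] K = evalHom q) :
    ∃ e : K ⊗[ℤ[X]] Hecke ℤ[X] X n ≃ₗ[K] Hecke K q n, ∀ c a, e (c ⊗ₜ a) = c • specialize q n a := by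
  have hX : algebraMap ℤ[X] K X = q := by simp [h]
  let _ : Algebra ℤ[X] (Hecke K q n) := Algebra.compHom _ (algebraMap ℤ[X] K)
  have _ : IsScalarTower ℤ[X] K (Hecke K q n) := IsScalarTower.of_algebraMap_eq' rfl
  let φ : Hecke ℤ[X] X n →ₐ[ℤ[X]] Hecke K q n :=
    { specialize q n with
      commutes' := fun f => by
        change specialize q n (algebraMap _ _ f) = algebraMap K _ (algebraMap ℤ[X] K f)
        rw [Algebra.algebraMap_eq_smul_one, specialize_smul, map_one, h,
          ← Algebra.algebraMap_eq_smul_one] }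
  let u : K ⊗[ℤ[X]] Hecke ℤ[X] X n →ₐ[K] Hecke K q n :=
    Algebra.TensorProduct.lift (Algebra.ofId K _) φ fun c a => Algebra.commutes c _
  obtain ⟨v, hv⟩ : ∃ v : Hecke K q n →ₐ[K] K ⊗[ℤ[X]] Hecke ℤ[X] X n,
      ∀ i, v (gen K q n i) = 1 ⊗ₜ gen ℤ[X] X n i :=
    ⟨lift (fun i => 1 ⊗ₜ gen ℤ[X] X n i)
      (fun i => by
        rw [Algebra.TensorProduct.tmul_mul_tmul, gen_mul_self, one_mul, TensorProduct.tmul_add,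
          TensorProduct.tmul_smul, TensorProduct.tmul_smul, ← Algebra.TensorProduct.one_def,
          ← hX, ← map_one (algebraMap ℤ[X] K), ← map_sub, algebraMap_smul, algebraMap_smul])
      (fun i j hij => by
        simp only [Algebra.TensorProduct.tmul_mul_tmul, gen_commute _ _ _ i j hij])
      (fun i j hij => by
        simp only [Algebra.TensorProduct.tmul_mul_tmul, gen_braid _ _ _ i j hij]),
      fun i => lift_gen _ _ _ _ i⟩
  have hu (c a) : u (c ⊗ₜ a) = c • specialize q n a :=
    (Algebra.TensorProduct.lift_tmul _ _ _ c a).trans (Algebra.smul_def c _).symm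
  clear_value u
  have huv : u.comp v = AlgHom.id K _ := hecke_algHom_ext n fun i => by
    simp [hu, hv, specialize_gen]
  have hvu : v.comp u = AlgHom.id K _ := by
    refine Algebra.TensorProduct.ext (Subsingleton.elim _ _) (hecke_algHom_ext n fun i => ?_)
    simp [hu, hv, specialize_gen]
  exact ⟨(AlgEquiv.ofAlgHom u v huv hvu).toLinearEquiv, hu⟩

theorem hasEigenvalue_of_injective {V W : Type*} [AddCommGroup V] [Module K V] [AddCommGroup W]
    [Module K W] {f : Module.End K V} {g : Module.End K W} (i : V →ₗ[K] W)
    (hi : Function.Injective i) (h : ∀ v, i (f v) = g (i v)) {x : K}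
    (hx : Module.End.HasEigenvalue f x) : Module.End.HasEigenvalue g x := by
  obtain ⟨v, hv⟩ := hx.exists_hasEigenvector
  refine Module.End.hasEigenvalue_of_hasEigenvector (x := i v) ⟨?_, fun h0 => hv.2 (hi (by simpa))⟩
  rw [Module.End.mem_eigenspace_iff, ← h, hv.apply_eq_smul, map_smul]

/-- Right and left multiplication by an element of a finite-dimensional algebra have the same
eigenvalues. -/
theorem exists_mul_eq_of_hasEigenvalue_mulRight {H : Type*} [Ring H] [Algebra K H]
    [FiniteDimensional K H] {a : H} {e : K}
    (h : Module.End.HasEigenvalue (LinearMap.mulRight K a) e) : ∃ v ≠ 0, a * v = e • v := by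
  obtain ⟨v, hv⟩ := h.exists_hasEigenvector
  have hv' : v * (a - e • 1) = 0 := by
    have := hv.apply_eq_smul
    rw [LinearMap.mulRight_apply] at this
    rw [mul_sub, this, mul_smul_comm, mul_one, sub_self]
  by_contra! hne
  have hinj : Function.Injective (LinearMap.mulLeft K (a - e • 1)) := by
    refine (injective_iff_map_eq_zero _).mpr fun w hw => ?_
    by_contra h0
    refine hne w h0 ?_
    rwa [LinearMap.mulLeft_apply, sub_mul, smul_mul_assoc, one_mul, sub_eq_zero] at hw
  obtain ⟨b, hb⟩ := LinearMap.injective_iff_surjective.mp hinj 1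
  rw [LinearMap.mulLeft_apply] at hb
  exact hv.2 (by rw [← mul_one v, ← hb, ← mul_assoc, hv', zero_mul])

end BaseChange

/-! ### The generic field -/

section Generic

/-- An algebraically closed field over which the indeterminate is generic. -/
abbrev GenericField : Type := AlgebraicClosure (FractionRing ℤ[X])

theorem algebraMap_genericField_injective :
    Function.Injective (algebraMap ℤ[X] GenericField) := by
  rw [IsScalarTower.algebraMap_eq ℤ[X] (FractionRing ℤ[X]) GenericField, RingHom.coe_comp]
  exact (algebraMap (FractionRing ℤ[X]) GenericField).injective.comp
    (IsFractionRing.injective ℤ[X] (FractionRing ℤ[X]))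

theorem algebraMap_genericField :
    algebraMap ℤ[X] GenericField = evalHom (algebraMap ℤ[X] GenericField X) :=
  Polynomial.ringHom_ext (by simp) (by simp)

instance : Module.Flat ℤ[X] GenericField :=
  have : Module.Flat ℤ[X] (FractionRing ℤ[X]) := IsLocalization.flat _ (nonZeroDivisors ℤ[X])
  Module.Flat.trans ℤ[X] (FractionRing ℤ[X]) GenericField

theorem qFactorial_ne_zero (k : ℕ) : qFactorial (X : ℤ[X]) k ≠ 0 := by
  refine fun h => ?_
  have h1 := congrArg (Polynomial.eval 1) h
  simp [qFactorial, qInt, eval_prod, eval_finsetSum, Finset.prod_eq_zero_iff] at h1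

instance (n : ℕ) : Module.Free ℤ[X] (Hecke ℤ[X] X n) := hecke_free X_ne_zero

theorem evalHom_map_natCast {K : Type*} [Field K] (q : K) (p : ℕ[X]) :
    evalHom q (p.map (Nat.castRingHom ℤ)) = aeval q p := by
  rw [coe_eval₂RingHom, eval₂_map, aeval_def]
  congr 1
  ext; simp

/-- The generic eigenvalues of `R_{n,k}` lie in `ℕ[q]`, viewed inside `ℤ[q]`. -/
theorem exists_eq_aeval_of_hasEigenvalue_baseChange {n k : ℕ} {e : GenericField}
    (h : Module.End.HasEigenvalue ((LinearMap.mulRight ℤ[X]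
      (genericRandomToRandom n k)).baseChange GenericField :
        Module.End GenericField (GenericField ⊗[ℤ[X]] Hecke ℤ[X] X n)) e) :
    ∃ s ∈ Set.range (Polynomial.map (Nat.castRingHom ℤ)), e = algebraMap ℤ[X] GenericField s := by
  set q := algebraMap ℤ[X] GenericField X with hq
  obtain ⟨E, hE⟩ := exists_baseChange_equiv q n algebraMap_genericField
  have h1 :
      Module.End.HasEigenvalue (LinearMap.mulRight GenericField (randomToRandom q n k)) e := by
    refine hasEigenvalue_of_injective E.toLinearMap E.injective (fun v => ?_) h
    induction v with
    | zero => simp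
    | add x y hx hy => rw [map_add, map_add, hx, hy, map_add, map_add]
    | tmul c a => simp [hE, randomToRandom]
  obtain ⟨v, hv, h2⟩ := exists_mul_eq_of_hasEigenvalue_mulRight h1
  have hinj := algebraMap_genericField_injective
  obtain ⟨p, hp⟩ := exists_eigenvalue_eq_aeval (k := k)
    (fun h0 => X_ne_zero (hinj (h0.trans (map_zero _).symm)))
    (fun h0 => X_ne_C 1 (hinj (h0.trans (map_one _).symm)))
    (by
      rw [← evalHom_qFactorial, ← algebraMap_genericField]
      exact fun h0 => qFactorial_ne_zero k (hinj (h0.trans (map_zero _).symm)))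
    (qFactorial_smul_randomToRandom q n k) hv h2
  refine ⟨_, ⟨p, rfl⟩, ?_⟩
  rw [algebraMap_genericField, evalHom_map_natCast, hp]

/-- Submodules of the Hecke algebra over `ℤ[q]` are torsion-free. -/
theorem tmul_one_injective_of_le_hecke {n : ℕ} {M : Type*} [AddCommGroup M] [Module ℤ[X] M]
    (i : M →ₗ[ℤ[X]] Hecke ℤ[X] X n) (hi : Function.Injective i) :
    Function.Injective fun m : M => (1 : GenericField) ⊗ₜ[ℤ[X]] m := by
  have h1 : Function.Injective fun a : Hecke ℤ[X] X n => (1 : GenericField) ⊗ₜ[ℤ[X]] a :=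
    Algebra.TensorProduct.includeRight_injective algebraMap_genericField_injective
  intro m m' h
  refine hi (h1 ?_)
  have := congrArg (i.lTensor GenericField) h
  simpa using this

/-- The eigenvalues of `R_{n,k}` on a submodule of the generic Hecke algebra, after
specialization. -/
theorem exists_finset_nonneg {n k : ℕ} {M : Type*} [AddCommGroup M] [Module ℤ[X] M]
    [Module.Finite ℤ[X] M] (i : M →ₗ[ℤ[X]] Hecke ℤ[X] X n) (hi : Function.Injective i)
    (f : Module.End ℤ[X] M) (hf : ∀ m, i (f m) = i m * genericRandomToRandom n k) :
    ∃ P : Finset ℕ[X], ∀ (K : Type*) [Field K] (q x : K),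
      letI := evalAlgebra q
      Module.End.HasEigenvalue (f.baseChange K : Module.End K (K ⊗[ℤ[X]] M)) x ↔
        ∃ p ∈ P, x = aeval q p := by
  classical
  obtain ⟨P, hP, h⟩ := exists_finset_hasEigenvalue_iff algebraMap_genericField_injective
    (tmul_one_injective_of_le_hecke i hi) f (Set.range (Polynomial.map (Nat.castRingHom ℤ)))
    fun e he => exists_eq_aeval_of_hasEigenvalue_baseChange (n := n) (k := k) <| by
      refine hasEigenvalue_of_injective (i.baseChange GenericField)
        (Module.Flat.lTensor_preserves_injective_linearMap i hi) (fun v => ?_) he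
      induction v with
      | zero => simp
      | add x y hx hy => rw [map_add, map_add, hx, hy, map_add, map_add]
      | tmul c a => simp [hf]
  choose! g hg using hP
  refine ⟨P.image g, fun K _ q x => ?_⟩
  let _ := evalAlgebra q
  rw [h K x]
  have key : ∀ s ∈ P, algebraMap ℤ[X] K s = aeval q (g s) := fun s hs => by
    rw [← evalHom_map_natCast, hg s hs]; rfl
  constructor
  · rintro ⟨s, hs, rfl⟩
    exact ⟨g s, Finset.mem_image_of_mem g hs, key s hs⟩
  · rintro ⟨p, hp, rfl⟩
    obtain ⟨s, hs, rfl⟩ := Finset.mem_image.mp hp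
    exact ⟨s, hs, (key s hs).symm⟩

end Generic

/-! ### The action on the Specht module -/

section SpechtAction

variable {n : ℕ} (μ : YoungDiagram) (hμ : μ.card = n) {K : Type*} [Field K] (q : K)

/-- The action of `H_n(q)` on its Specht module is induced by the generic action. -/
theorem spechtAction_specialize (a : Hecke ℤ[X] X n) :
    (spechtAction μ hμ q (specialize q n a)).unop = spechtMul μ hμ q a := by
  induction a using hecke_induction with
  | halg r =>
    rw [Algebra.algebraMap_eq_smul_one, specialize_smul, spechtMul_smul, spechtMul_one]
    simp
  | hgen i => simp [specialize_gen, spechtAction]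
  | hmul a b ha hb => simp [spechtMul_mul, ha, hb]
  | hadd a b ha hb => simp [spechtMul_add, ha, hb]

end SpechtAction

end

end HeckeShuffle

theorem mainTheorem3 (n k : ℕ) :
    (∃! r : HeckeShuffle.Hecke ℤ[X] X n,
      HeckeShuffle.qFactorial (X : ℤ[X]) k • r =
        HeckeShuffle.kRandomToBottom ℤ[X] X n k * HeckeShuffle.kBottomToRandom ℤ[X] X n k) ∧
    (∃ P : Finset ℕ[X], ∀ (K : Type*) [Field K] (q x : K),
      Module.End.HasEigenvalue (LinearMap.mulRight K (HeckeShuffle.randomToRandom q n k)) x ↔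
        ∃ p ∈ P, x = aeval q p) ∧
    (∀ (μ : YoungDiagram) (hμ : μ.card = n),
      ∃ P : Finset ℕ[X], ∀ (K : Type*) [Field K] (q x : K),
        Module.End.HasEigenvalue
            (HeckeShuffle.spechtAction μ hμ q (HeckeShuffle.randomToRandom q n k)).unop x ↔
          ∃ p ∈ P, x = aeval q p) := by
  open HeckeShuffle in
  refine ⟨?_, ?_, fun μ hμ => ?_⟩
  · obtain ⟨r, hr⟩ := exists_qFactorial_smul_eq (R := ℤ[X]) (q := X) (n := n) k
    refine ⟨r, hr, fun r' hr' => ?_⟩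
    exact smul_right_injective _ (qFactorial_ne_zero k) (hr'.trans hr.symm)
  · obtain ⟨P, hP⟩ := exists_finset_nonneg (k := k) (LinearMap.id : Hecke ℤ[X] X n →ₗ[ℤ[X]] _)
      Function.injective_id (LinearMap.mulRight ℤ[X] (genericRandomToRandom n k)) fun m => rfl
    refine ⟨P, fun K _ q x => ?_⟩
    rw [← hP K q x]
    let _ := evalAlgebra q
    obtain ⟨e, he⟩ := exists_baseChange_equiv q n rfl
    have h (v) : e ((LinearMap.mulRight ℤ[X] (genericRandomToRandom n k)).baseChange K v) =
        LinearMap.mulRight K (randomToRandom q n k) (e v) := by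
      induction v with
      | zero => simp
      | add x y hx hy => rw [map_add, map_add, hx, hy, map_add, map_add]
      | tmul c a => simp [he, randomToRandom]
    exact ⟨hasEigenvalue_of_injective e.symm.toLinearMap e.symm.injective fun v => by
        obtain ⟨v, rfl⟩ := e.surjective v
        simp [← h],
      hasEigenvalue_of_injective e.toLinearMap e.injective h⟩
  · have : Module.Finite ℤ[X] (genericSpecht μ hμ) := by
      unfold genericSpecht; infer_instance
    obtain ⟨P, hP⟩ := exists_finset_nonneg (k := k) (genericSpecht μ hμ).subtype
      (Submodule.subtype_injective _) (genericSpechtMul μ hμ (genericRandomToRandom n k))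
      fun m => rfl
    refine ⟨P, fun K _ q x => ?_⟩
    rw [randomToRandom, spechtAction_specialize]
    exact hP K q x
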